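/- Let $M$ be a compact smooth $m$-dimensional Riemannian manifold without boundary, let $d+n=m$, and let $V$ be a finite-dimensional space of smooth vector fields on $M$ with a Euclidean metric. For $t\in V$ let $\phi_t$ be the exponential (time-one map of the flow) of the vector field $t$. Submanifolds are embedded, smooth and without boundary. For a submanifold $N\subset M$ and constants $C,\epsilon_0>0$ consider the assertion $(\ast)$ For every $0<\epsilon<\epsilon_0$, every compact $n$-dimensional submanifold $N'\subset M$ and every relatively open $U\subset N'$ there is $t\in V$ with $|t|<\epsilon$ such that $\phi_t(N)$ is transverse to $N'$ and $$|\phi_t(N)\cap U|\le C\epsilon^{-n}\,\mathrm{Vol}(U),$$ where $\mathrm{Vol}$ is the $n$-dimensional Riemannian volume. 1. Let $N\subset M$ be a compact $d$-dimensional submanifold such that for every $x\in N$ the evaluation $V\to T_xM/T_xN$ is surjective. Then there are $C,\epsilon_0>0$ such that $(\ast)$ holds for $N$. In particular $C$ does not depend on $\epsilon$, $N'$ or $U$. 2. The constants depend on $N$ only through its $C^1$-regularity and a quantitative bound for the surjectivity. That is, let $\mathcal F$ be any family of compact $d$-dimensional submanifolds of $M$ such that (a) the members of $\mathcal F$ have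 uniform $C^1$-regularity: for every $p\in M$ and $\eta>0$ there is a neighbourhood $O$ of $p$, contained in the domain of a chart $\kappa$ at $p$ (fixed for each $p$), such that for every $N\in\mathcal F$ there is a $d$-dimensional linear subspace $T\subset\mathbb R^m$ with $\mathrm{dist}(\kappa(y)-\kappa(x),T)\le\eta\,|\kappa(y)-\kappa(x)|$ for all $x,y\in N\cap O$ (that is, in the chart, $N\cap O$ lies on a graph of slope controlled by $\eta$ over a $d$-plane); (b) there is a constant $K$ such that for all $N\in\mathcal F$, $x\in N$ and $w\in T_xM$ there is $v\in V$ with $|v|\le K|w|$ and $w-v(x)\in T_xN$. Then there are $C,\epsilon_0>0$ such that $(\ast)$ holds, with these same constants, for all $N\in\mathcal F$. -/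

import Mathlib

open scoped Manifold ContDiff ENNReal Topology MeasureTheory
open Bundle

noncomputable section

/-- `S` is an embedded smooth submanifold (without boundary) of dimension `d` of the
`m`-dimensional smooth manifold `M`: around each of its points there is a chart of the smooth
structure of `M` in which `S` is a `d`-dimensional linear subspace. -/
def IsEmbeddedSubmanifold {m : ℕ} {M : Type*} [TopologicalSpace M]
    [ChartedSpace (EuclideanSpace ℝ (Fin m)) M] (d : ℕ) (S : Set M) : Prop :=
  ∀ x ∈ S, ∃ κ ∈ IsManifold.maximalAtlas (𝓡 m) ∞ M, x ∈ κ.source ∧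
    ∃ L : Submodule ℝ (EuclideanSpace ℝ (Fin m)), Module.finrank ℝ L = d ∧
      ∀ y ∈ κ.source, (y ∈ S ↔ κ y ∈ L)

/-- The tangent space `T_x S` inside `T_x M`: the span of the velocities at time `0` of the curves
that are at `x` at time `0` and run in `S` for small times (for an embedded submanifold these
velocities already form a linear subspace). -/
def tangentSpaceOfSet {m : ℕ} {M : Type*} [TopologicalSpace M]
    [ChartedSpace (EuclideanSpace ℝ (Fin m)) M] (S : Set M) (x : M) :
    Submodule ℝ (TangentSpace (𝓡 m) x) :=
  Submodule.span ℝ {w : TangentSpace (𝓡 m) x | ∃ γ : ℝ → M, γ 0 = x ∧ (∀ᶠ s in 𝓝 0, γ s ∈ S) ∧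
    HasMFDerivAt 𝓘(ℝ, ℝ) (𝓡 m) γ 0
      ((1 : ℝ →L[ℝ] ℝ).smulRight (w : EuclideanSpace ℝ (Fin m)))}

/-- `A` and `B` intersect transversely: `T_x A + T_x B = T_x M` at every common point `x`. -/
def IntersectTransversely {m : ℕ} {M : Type*} [TopologicalSpace M]
    [ChartedSpace (EuclideanSpace ℝ (Fin m)) M] (A B : Set M) : Prop :=
  ∀ x ∈ A ∩ B, tangentSpaceOfSet (m := m) A x ⊔ tangentSpaceOfSet (m := m) B x = ⊤

open Classical in
/-- The exponential of a vector field `v`, i.e. its time-one map: it sends `x` to `γ 1`, where `γ`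
is the integral curve of `v` with `γ 0 = x`. (On a compact manifold without boundary and for smooth
`v` this curve exists for all times and is unique; the value `x` for a field without such a curve
is a placeholder.) -/
def timeOneMap {m : ℕ} {M : Type*} [TopologicalSpace M]
    [ChartedSpace (EuclideanSpace ℝ (Fin m)) M] (v : (x : M) → TangentSpace (𝓡 m) x) (x : M) : M :=
  if h : ∃ γ : ℝ → M, γ 0 = x ∧ IsMIntegralCurve γ v then h.choose 1 else x

/-- The space of vector fields `X t`, `t ∈ V`, surjects onto the normal space `T_x M / T_x N` at
every point `x` of `N`. -/
def SurjectsOntoNormal {m : ℕ} {M : Type*} [TopologicalSpace M]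
    [ChartedSpace (EuclideanSpace ℝ (Fin m)) M] [IsManifold (𝓡 m) ∞ M]
    {V : Type*} [AddCommGroup V] [Module ℝ V]
    (X : V →ₗ[ℝ] Cₛ^∞⟮𝓡 m; EuclideanSpace ℝ (Fin m), (TangentSpace (𝓡 m) : M → Type _)⟯)
    (N : Set M) : Prop :=
  ∀ x ∈ N, ∀ w : TangentSpace (𝓡 m) x, ∃ t : V, w - X t x ∈ tangentSpaceOfSet N x

/-- Quantitative form for a family `F` of submanifolds: with one constant `K`, every normal vector
at every point of every member of `F` is hit by a vector field of controlled size. -/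
def UniformlySurjectsOntoNormal {m : ℕ} {M : Type*} [TopologicalSpace M]
    [ChartedSpace (EuclideanSpace ℝ (Fin m)) M] [IsManifold (𝓡 m) ∞ M]
    [RiemannianBundle (fun x : M => TangentSpace (𝓡 m) x)]
    {V : Type*} [NormedAddCommGroup V] [InnerProductSpace ℝ V]
    (X : V →ₗ[ℝ] Cₛ^∞⟮𝓡 m; EuclideanSpace ℝ (Fin m), (TangentSpace (𝓡 m) : M → Type _)⟯)
    (F : Set (Set M)) : Prop :=
  ∃ K : ℝ, ∀ N ∈ F, ∀ x ∈ N, ∀ w : TangentSpace (𝓡 m) x,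
    ∃ t : V, ‖t‖ ≤ K * ‖w‖ ∧ w - X t x ∈ tangentSpaceOfSet N x

/-- The members of the family `F` of `d`-dimensional submanifolds of `M` have uniformly controlled
`C¹`-regularity: near every point `p` of `M`, and for every slope `η > 0`, there is a neighbourhood
`O` of `p`, the same for all members, such that in a chart at `p` the part in `O` of each member
lies on a graph of slope at most `η` over some `d`-dimensional plane. This is a common modulus of
continuity for the first derivatives of local graph representations. (As the condition is imposed
for all `η`, it does not depend on the smooth chart used at `p`.) -/
def UniformlyC1 {m : ℕ} {M : Type*} [TopologicalSpace M]
    [ChartedSpace (EuclideanSpace ℝ (Fin m)) M] (d : ℕ) (F : Set (Set M)) : Prop :=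
  ∀ p : M, ∀ η : ℝ, 0 < η → ∃ O ∈ 𝓝 p, O ⊆ (chartAt (EuclideanSpace ℝ (Fin m)) p).source ∧
    ∀ N ∈ F, ∃ T : Submodule ℝ (EuclideanSpace ℝ (Fin m)), Module.finrank ℝ T = d ∧
      ∀ x ∈ N ∩ O, ∀ y ∈ N ∩ O, ∃ u ∈ T,
        ‖chartAt (EuclideanSpace ℝ (Fin m)) p y - chartAt (EuclideanSpace ℝ (Fin m)) p x - u‖ ≤
          η * ‖chartAt (EuclideanSpace ℝ (Fin m)) p y - chartAt (EuclideanSpace ℝ (Fin m)) p x‖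

/-- The assertion about `N` with the constants `C` and `ε₀`: for all `0 < ε < ε₀`, all compact
`n`-dimensional submanifolds `N'` and all relatively open `U ⊆ N'` there is `t` in the ball
`B(0, ε)` of `V` such that `φ_t(N)`, with `φ_t` the exponential of `X t`, is transverse to `N'` and
`|φ_t(N) ∩ U| ≤ C ε⁻ⁿ Vol(U)`. The volume is the `n`-dimensional Hausdorff measure of the Riemannian
distance of `M`, normalized to be the Riemannian volume. -/
def PerturbedIntersectionBound {m : ℕ} {M : Type*} [EMetricSpace M] [MeasurableSpace M]
    [BorelSpace M] [ChartedSpace (EuclideanSpace ℝ (Fin m)) M] [IsManifold (𝓡 m) ∞ M]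
    {V : Type*} [NormedAddCommGroup V] [InnerProductSpace ℝ V]
    (X : V →ₗ[ℝ] Cₛ^∞⟮𝓡 m; EuclideanSpace ℝ (Fin m), (TangentSpace (𝓡 m) : M → Type _)⟯)
    (n : ℕ) (N : Set M) (C ε₀ : ℝ) : Prop :=
  ∀ ε : ℝ, 0 < ε → ε < ε₀ → ∀ N' : Set M, IsCompact N' → IsEmbeddedSubmanifold (m := m) n N' →
    ∀ U : Set M, (∃ O : Set M, IsOpen O ∧ U = N' ∩ O) →
      ∃ t ∈ Metric.ball (0 : V) ε,
        IntersectTransversely (m := m) (timeOneMap (X t) '' N) N' ∧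
        (((timeOneMap (X t) '' N) ∩ U).encard : ℝ≥0∞) ≤
          ENNReal.ofReal (C / ε ^ n) * MeasureTheory.Measure.euclideanHausdorffMeasure n U

end

/-! The proof is a first-moment argument over the ball B(0, ε) of V. Put k = dim V. The average over
t of |φ_t(N) ∩ U| is at most C ε⁻ⁿ Vol(U), and φ_t(N) is transverse to N' for almost every t. Hence
some t outside the null set does no worse than the average.

Both facts rest on one local estimate, `ControlledAt.exists_separation`. In a chart at p, the map
(t, x) ↦ φ_t(x) is strictly approximated near (0, p) by (t, x) ↦ x + X_t(p), and N is nearly flat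
over a plane T. Surjectivity modulo T provides an n-dimensional W ⊂ V whose values at p form a
quantitative complement of T. Absorbing the errors gives |x - x'| + |t - t'| ≤ C (|φ_t(x) -
φ_{t'}(x')| + |P(t - t')|) for x, x' in N near p, where P is the orthogonal projection with kernel
W.

Counting: the parameters for which a small piece of φ_t(N) meets a set of diameter ρ have slices of
diameter O(ρ) parallel to W, so they fill a volume O(ε^(k-n) ρⁿ) (`volume_closure_le_of_slices`).
Summing over fine covers of U gives an inequality of Eilenberg type
(`exists_lintegral_le_hausdorffMeasure`). Division by the volume of the ball, of order ε^k, leaves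
ε⁻ⁿ.

Transversality: by separation, t is a function of the intersection point, given by n coordinates on
N', and of P t. The domain lies in a space of dimension n + (k - n) = k, the function is
differentiable along its domain, and its derivative is not injective at a tangency. The
equal-dimensional Sard lemma, which needs no more than differentiability, makes such t a null set
(`SeparatedOn.volume_tangency_eq_zero`).

Submanifolds enter the constants only through `ControlledAt`, so a single N and a uniform family are
treated alike. -/

/-! ### Local flows depending on a parameter -/

section LocalFlow

open Metric Set

open scoped NNReal

/-- The Picard-Lindelöf theorem, with the additional information that the solution stays in the
closed ball in which the assumptions hold. -/
theorem IsPicardLindelof.exists_eq_mem_closedBall_hasDerivWithinAt {E : Type*}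
    [NormedAddCommGroup E] [NormedSpace ℝ E] [CompleteSpace E] {f : ℝ → E → E} {tmin tmax : ℝ}
    {t₀ : Icc tmin tmax} {x₀ x : E} {a r L K : ℝ≥0}
    (hf : IsPicardLindelof f t₀ x₀ a r L K) (hx : x ∈ closedBall x₀ r) :
    ∃ α : ℝ → E, α t₀ = x ∧ (∀ t, α t ∈ closedBall x₀ a) ∧
      ∀ t ∈ Icc tmin tmax, HasDerivWithinAt α (f t (α t)) (Icc tmin tmax) t := by
  obtain ⟨α, hα⟩ := ODE.FunSpace.exists_isFixedPt_next hf hx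
  refine ⟨α.compProj, by rw [ODE.FunSpace.compProj_val, ← hα, ODE.FunSpace.next_apply₀],
    fun t ↦ α.compProj_mem_closedBall hf.mul_max_le, fun t ht ↦ ?_⟩
  apply ODE.hasDerivWithinAt_picard_Icc t₀.2 hf.continuousOn_uncurry
    α.continuous_compProj.continuousOn (fun _ ht' ↦ α.compProj_mem_closedBall hf.mul_max_le)
    x ht |>.congr_of_mem _ ht
  intro t' ht'
  nth_rw 1 [← hα]
  rw [ODE.FunSpace.compProj_of_mem ht', ODE.FunSpace.next_apply]

/-- A form of Grönwall's inequality on `[0, 1]`. -/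
theorem norm_le_two_mul_of_norm_deriv_le {E : Type*} [NormedAddCommGroup E] [NormedSpace ℝ E]
    {f f' : ℝ → E} {c : ℝ} (hc : 0 ≤ c) (h0 : f 0 = 0)
    (hf : ∀ τ ∈ Icc (0 : ℝ) 1, HasDerivWithinAt f (f' τ) (Icc 0 1) τ)
    (hb : ∀ τ ∈ Icc (0 : ℝ) 1, ‖f' τ‖ ≤ ‖f τ‖ + c) :
    ∀ τ ∈ Icc (0 : ℝ) 1, ‖f τ‖ ≤ 2 * c := by
  intro τ hτ
  have := norm_le_gronwallBound_of_norm_deriv_right_le (f := f) (f' := f') (δ := 0) (K := 1)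
    (ε := c) (a := 0) (b := 1) (fun τ hτ ↦ (hf τ hτ).continuousWithinAt)
    (fun τ hτ ↦ (hf τ ⟨hτ.1, hτ.2.le⟩).mono_of_mem_nhdsWithin (Icc_mem_nhdsGE_of_mem hτ))
    (by simp [h0]) (fun τ hτ ↦ by simpa using hb τ ⟨hτ.1, hτ.2.le⟩) τ hτ
  rw [gronwallBound_of_K_ne_0 one_ne_zero] at this
  have h3 : Real.exp (1 * (τ - 0)) ≤ 3 :=
    (Real.exp_le_exp.2 (by linarith [hτ.2])).trans (Real.exp_one_lt_three.le)
  calc ‖f τ‖ ≤ _ := this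
    _ = c * (Real.exp (1 * (τ - 0)) - 1) := by ring
    _ ≤ c * 2 := by gcongr; linarith
    _ = 2 * c := by ring

/-- Quadratic bound for the remainder of a function with Lipschitz derivative. -/
theorem norm_sub_sub_le_of_lipschitz_deriv {E F : Type*} [NormedAddCommGroup E] [NormedSpace ℝ E]
    [NormedAddCommGroup F] [NormedSpace ℝ F] {g : E → F} {g' : E → E →L[ℝ] F} {s : Set E} {L : ℝ}
    (hs : Convex ℝ s) (hg : ∀ x ∈ s, HasFDerivAt g (g' x) x)
    (hL : ∀ x ∈ s, ∀ y ∈ s, ‖g' x - g' y‖ ≤ L * ‖x - y‖) (hL0 : 0 ≤ L) {x y : E}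
    (hx : x ∈ s) (hy : y ∈ s) : ‖g y - g x - g' x (y - x)‖ ≤ L * ‖y - x‖ ^ 2 := by
  have key := (convex_segment (𝕜 := ℝ) x y).norm_image_sub_le_of_norm_hasFDerivWithin_le'
    (f := g) (f' := g') (φ := g' x) (C := L * ‖y - x‖)
    (fun z hz ↦ (hg z (hs.segment_subset hx hy hz)).hasFDerivWithinAt)
    (fun z hz ↦ (hL z (hs.segment_subset hx hy hz) x hx).trans (by
      gcongr
      rw [← dist_eq_norm, ← dist_eq_norm, dist_comm y x]
      obtain ⟨a, b, ha, hb, hab, rfl⟩ := hz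
      rw [dist_eq_norm, dist_eq_norm]
      have : a • x + b • y - x = b • (y - x) := by
        rw [← eq_sub_iff_add_eq] at hab
        rw [hab]; module
      rw [this, norm_smul, Real.norm_eq_abs, abs_of_nonneg hb, norm_sub_rev x y]
      exact mul_le_of_le_one_left (norm_nonneg _) (by linarith)))
    (left_mem_segment ℝ x y) (right_mem_segment ℝ x y)
  calc _ ≤ _ := key
    _ = _ := by ring

set_option synthInstance.maxHeartbeats 200000 in
set_option maxHeartbeats 1000000 in
/-- Local flow of a family of vector fields `e ↦ g e t` depending linearly on a parameter `t`, for
small parameters and times in `(-2, 2)`: it exists, stays close to the base point, its time-one map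
is differentiable in the parameter and the initial point, and is strictly approximated by
`(t, x) ↦ x + g e₀ t`. -/
theorem exists_local_flow {V E : Type*} [NormedAddCommGroup V] [NormedSpace ℝ V]
    [NormedAddCommGroup E] [NormedSpace ℝ E] [CompleteSpace E] {g : E → V →L[ℝ] E} {e₀ : E}
    (hg : ContDiffAt ℝ 2 g e₀) {η : ℝ} (hη : 0 < η) {s : Set E} (hs : s ∈ 𝓝 e₀) :
    ∃ r > 0, ∃ ε > 0, ∃ γ : V → E → ℝ → E,
      (∀ t ∈ ball (0 : V) ε, ∀ x ∈ ball e₀ r, γ t x 0 = x ∧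
        ∀ τ ∈ Ioo (-2 : ℝ) 2, γ t x τ ∈ s ∧ HasDerivAt (γ t x) (g (γ t x τ) t) τ) ∧
      (∀ t ∈ ball (0 : V) ε, ∀ t' ∈ ball (0 : V) ε, ∀ x ∈ ball e₀ r, ∀ x' ∈ ball e₀ r,
        ‖γ t x 1 - γ t' x' 1 - (x - x') - g e₀ (t - t')‖ ≤ η * (‖x - x'‖ + ‖t - t'‖)) ∧
      (∀ t ∈ ball (0 : V) ε, ∀ x ∈ ball e₀ r,
        DifferentiableAt ℝ (fun q : V × E ↦ γ q.1 q.2 1) (t, x)) := by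
  -- the ball in which everything is controlled
  obtain ⟨K₁, s₁, hs₁, hK₁⟩ := (hg.of_le one_le_two).exists_lipschitzOnWith
  obtain ⟨K₂, s₂, hs₂, hK₂⟩ :=
    (hg.fderiv_right (m := 1) (by norm_num)).exists_lipschitzOnWith
  have hd : ∀ᶠ e in 𝓝 e₀, DifferentiableAt ℝ g e :=
    (hg.eventually (by simp)).mono fun e he ↦ he.differentiableAt (by simp)
  obtain ⟨R₀, hR₀, hR₀s⟩ := Metric.mem_nhds_iff.1
    (Filter.inter_mem (Filter.inter_mem hs hd) (Filter.inter_mem hs₁ hs₂))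
  set L : ℝ := max 1 (max K₁ K₂) with hLdef
  have hL1 : 1 ≤ L := le_max_left _ _
  have hL0 : 0 < L := by linarith
  -- R ≤ 1 gives the uniform bounds B on g and D on its derivative; L * R ≤ η / 8 makes g oscillate
  -- little on the ball.
  set R : ℝ := min (R₀ / 2) (min 1 (η / (8 * L))) with hRdef
  have hR : 0 < R := by positivity
  have hRη : L * R ≤ η / 8 := by
    have : R ≤ η / (8 * L) := (min_le_right _ _).trans (min_le_right _ _)
    calc L * R ≤ L * (η / (8 * L)) := by gcongr
      _ = η / 8 := by field_simp
  have hR1 : R ≤ 1 := (min_le_right _ _).trans (min_le_left _ _)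
  have hball : closedBall e₀ R ⊆ ball e₀ R₀ :=
    closedBall_subset_ball ((min_le_left _ _).trans_lt (half_lt_self hR₀))
  have hlip : ∀ x ∈ closedBall e₀ R, ∀ y ∈ closedBall e₀ R, ‖g x - g y‖ ≤ L * ‖x - y‖ := by
    intro x hx y hy
    refine (hK₁.norm_sub_le (hR₀s (hball hx)).2.1 (hR₀s (hball hy)).2.1).trans ?_
    gcongr
    exact (le_max_left _ _).trans (le_max_right _ _)
  have hlip' : ∀ x ∈ closedBall e₀ R, ∀ y ∈ closedBall e₀ R,
      ‖fderiv ℝ g x - fderiv ℝ g y‖ ≤ L * ‖x - y‖ := by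
    intro x hx y hy
    refine (hK₂.norm_sub_le (hR₀s (hball hx)).2.2 (hR₀s (hball hy)).2.2).trans ?_
    gcongr
    exact (le_max_right _ _).trans (le_max_right _ _)
  have hdiff : ∀ x ∈ closedBall e₀ R, HasFDerivAt g (fderiv ℝ g x) x := fun x hx ↦
    (hR₀s (hball hx)).1.2.hasFDerivAt
  have he₀ : e₀ ∈ closedBall e₀ R := mem_closedBall_self hR.le
  set B : ℝ := ‖g e₀‖ + L with hBdef
  have hB0 : 0 < B := by positivity
  have hB : ∀ x ∈ closedBall e₀ R, ‖g x‖ ≤ B := by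
    intro x hx
    have h1 := hlip x hx e₀ he₀
    have h2 : ‖x - e₀‖ ≤ 1 := (mem_closedBall_iff_norm.1 hx).trans hR1
    calc ‖g x‖ = ‖g e₀ + (g x - g e₀)‖ := by congr 1; abel
      _ ≤ ‖g e₀‖ + ‖g x - g e₀‖ := norm_add_le _ _
      _ ≤ ‖g e₀‖ + L * 1 := by gcongr; exact h1.trans (by gcongr)
      _ = B := by rw [mul_one]
  set D : ℝ := ‖fderiv ℝ g e₀‖ + L with hDdef
  have hD0 : 0 < D := by positivity
  have hD : ∀ x ∈ closedBall e₀ R, ‖fderiv ℝ g x‖ ≤ D := by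
    intro x hx
    have h1 := hlip' x hx e₀ he₀
    have h2 : ‖x - e₀‖ ≤ 1 := (mem_closedBall_iff_norm.1 hx).trans hR1
    calc ‖fderiv ℝ g x‖ ≤ ‖fderiv ℝ g e₀‖ + ‖fderiv ℝ g x - fderiv ℝ g e₀‖ := by
          linarith [norm_sub_norm_le (fderiv ℝ g x) (fderiv ℝ g e₀)]
      _ ≤ ‖fderiv ℝ g e₀‖ + L * 1 := by gcongr; exact h1.trans (by gcongr)
      _ = D := by rw [mul_one]
  -- In order, the terms confine solutions up to time 2, make the Grönwall rate at most 1, bound the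
  -- linearized equation, and make the two errors of the strict estimate at most η / 8.
  set ε : ℝ := min (R / (4 * B)) (min (1 / (2 * L)) (min (1 / (2 * D))
    (min (η / (8 * L)) (η / (8 * L * B))))) with hεdef
  have hε : 0 < ε := by positivity
  have hεB : B * ε * 2 ≤ R / 2 := by
    calc B * ε * 2 ≤ B * (R / (4 * B)) * 2 := by gcongr; exact min_le_left _ _
      _ = R / 2 := by field_simp; norm_num
  have hεL : L * ε ≤ 1 / 2 := by
    calc L * ε ≤ L * (1 / (2 * L)) := by
          gcongr; exact (min_le_right _ _).trans (min_le_left _ _)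
      _ = 1 / 2 := by field_simp
  have hεD : D * ε ≤ 1 / 2 := by
    calc D * ε ≤ D * (1 / (2 * D)) := by
          gcongr
          exact (min_le_right _ _).trans ((min_le_right _ _).trans (min_le_left _ _))
      _ = 1 / 2 := by field_simp
  have hεη : L * ε ≤ η / 8 := by
    calc L * ε ≤ L * (η / (8 * L)) := by
          gcongr
          exact (min_le_right _ _).trans ((min_le_right _ _).trans ((min_le_right _ _).trans
            (min_le_left _ _)))
      _ = η / 8 := by field_simp
  have hεηB : L * ε * B ≤ η / 8 := by
    calc L * ε * B ≤ L * (η / (8 * L * B)) * B := by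
          gcongr
          exact (min_le_right _ _).trans ((min_le_right _ _).trans ((min_le_right _ _).trans
            (min_le_right _ _)))
      _ = η / 8 := by field_simp
  -- existence of the flow
  have hex : ∀ t ∈ ball (0 : V) ε, ∀ x ∈ ball e₀ (R / 2), ∃ α : ℝ → E, α 0 = x ∧
      (∀ τ, α τ ∈ closedBall e₀ R) ∧
      ∀ τ ∈ Ioo (-2 : ℝ) 2, HasDerivAt α (g (α τ) t) τ := by
    intro t ht x hx
    have ht' : ‖t‖ ≤ ε := (mem_ball_zero_iff.1 ht).le
    have hpl : IsPicardLindelof (fun _ e ↦ g e t) (tmin := -2) (tmax := 2) ⟨0, by norm_num⟩ e₀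
        (.mk R hR.le) (.mk (R / 2) (by positivity)) (.mk (B * ε) (by positivity))
        (.mk (L * ε) (by positivity)) := by
      refine IsPicardLindelof.of_time_independent ?_ ?_ ?_
      · intro e he
        exact (ContinuousLinearMap.le_opNorm _ _).trans
          (mul_le_mul (hB e he) ht' (norm_nonneg _) hB0.le)
      · refine LipschitzOnWith.of_dist_le_mul fun e he e' he' ↦ ?_
        rw [dist_eq_norm, dist_eq_norm, ← sub_apply]
        refine (ContinuousLinearMap.le_opNorm _ _).trans ?_
        calc ‖g e - g e'‖ * ‖t‖ ≤ (L * ‖e - e'‖) * ε :=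
              mul_le_mul (hlip e he e' he') ht' (norm_nonneg _) (by positivity)
          _ = L * ε * ‖e - e'‖ := by ring
      · simp only [sub_zero, zero_sub, neg_neg, max_self]
        change B * ε * 2 ≤ R - R / 2
        linarith
    obtain ⟨α, h0, hmem, hα⟩ := hpl.exists_eq_mem_closedBall_hasDerivWithinAt (x := x)
      (ball_subset_closedBall hx)
    exact ⟨α, h0, hmem, fun τ hτ ↦ (hα τ (Ioo_subset_Icc_self hτ)).hasDerivAt
      (Icc_mem_nhds hτ.1 hτ.2)⟩
  classical
  choose! γ hγ0 hγmem hγd using hex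
  have hsub : Icc (0 : ℝ) 1 ⊆ Ioo (-2 : ℝ) 2 := fun τ hτ ↦
    ⟨by linarith [hτ.1], by linarith [hτ.2]⟩
  -- the basic estimate
  have hest : ∀ t ∈ ball (0 : V) ε, ∀ t' ∈ ball (0 : V) ε, ∀ x ∈ ball e₀ (R / 2),
      ∀ x' ∈ ball e₀ (R / 2), ∀ τ ∈ Icc (0 : ℝ) 1,
      ‖γ t x τ - γ t' x' τ - (x - x') - τ • g e₀ (t - t')‖ ≤ η * (‖x - x'‖ + ‖t - t'‖) := by
    intro t ht t' ht' x hx x' hx' τ hτ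
    have hn' : ‖t'‖ ≤ ε := (mem_ball_zero_iff.1 ht').le
    have := norm_le_two_mul_of_norm_deriv_le
      (f := fun τ ↦ γ t x τ - γ t' x' τ - (x - x') - τ • g e₀ (t - t'))
      (f' := fun τ ↦ g (γ t x τ) t - g (γ t' x' τ) t' - (1 : ℝ) • g e₀ (t - t'))
      (c := η / 4 * (‖x - x'‖ + ‖t - t'‖)) (by positivity)
      (by simp [hγ0 t ht x hx, hγ0 t' ht' x' hx'])
      (fun σ hσ ↦ ((((hγd t ht x hx σ (hsub hσ)).sub (hγd t' ht' x' hx' σ (hsub hσ))).sub_const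
        _).sub ((hasDerivAt_id σ).smul_const _)).hasDerivWithinAt)
      (fun σ hσ ↦ ?_) τ hτ
    · refine this.trans ?_
      have : 0 ≤ ‖x - x'‖ + ‖t - t'‖ := by positivity
      nlinarith
    · set y := γ t x σ
      set y' := γ t' x' σ
      have hy : y ∈ closedBall e₀ R := hγmem t ht x hx σ
      have hy' : y' ∈ closedBall e₀ R := hγmem t' ht' x' hx' σ
      set Z := y - y' - (x - x') - σ • g e₀ (t - t') with hZ
      -- The first term is small because g oscillates little, the second because t' is small. Since
      -- y - y' is again `Z` plus known terms, Grönwall's inequality closes the estimate.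
      have e1 : g y t - g y' t' - (1 : ℝ) • g e₀ (t - t')
          = (g y - g e₀) (t - t') + (g y - g y') t' := by
        simp only [sub_apply, map_sub, one_smul]; abel
      have n1 : ‖(g y - g e₀) (t - t')‖ ≤ L * R * ‖t - t'‖ :=
        (ContinuousLinearMap.le_opNorm _ _).trans (by
          gcongr
          exact (hlip y hy e₀ he₀).trans (by gcongr; exact mem_closedBall_iff_norm.1 hy))
      have n2 : ‖(g y - g y') t'‖ ≤ L * ‖y - y'‖ * ε :=
        (ContinuousLinearMap.le_opNorm _ _).trans
          (mul_le_mul (hlip y hy y' hy') hn' (norm_nonneg _) (by positivity))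
      have n3 : ‖y - y'‖ ≤ ‖Z‖ + ‖x - x'‖ + B * ‖t - t'‖ := by
        have : y - y' = Z + (x - x') + σ • g e₀ (t - t') := by rw [hZ]; abel
        rw [this]
        refine (norm_add_le _ _).trans (add_le_add (norm_add_le _ _) ?_)
        rw [norm_smul, Real.norm_eq_abs, abs_of_nonneg hσ.1]
        calc σ * ‖g e₀ (t - t')‖ ≤ 1 * (‖g e₀‖ * ‖t - t'‖) :=
              mul_le_mul hσ.2 (ContinuousLinearMap.le_opNorm _ _) (norm_nonneg _) zero_le_one
          _ ≤ B * ‖t - t'‖ := by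
              rw [one_mul]; gcongr; exact hB e₀ he₀
      rw [e1]
      calc _ ≤ ‖(g y - g e₀) (t - t')‖ + ‖(g y - g y') t'‖ := norm_add_le _ _
        _ ≤ L * R * ‖t - t'‖ + L * (‖Z‖ + ‖x - x'‖ + B * ‖t - t'‖) * ε := by
            refine add_le_add n1 (n2.trans ?_)
            gcongr
        _ = (L * ε) * ‖Z‖ + (L * R) * ‖t - t'‖ + (L * ε) * ‖x - x'‖
            + (L * ε * B) * ‖t - t'‖ := by ring
        _ ≤ 1 * ‖Z‖ + η / 8 * ‖t - t'‖ + η / 8 * ‖x - x'‖ + η / 8 * ‖t - t'‖ := by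
            gcongr; linarith
        _ ≤ ‖Z‖ + η / 4 * (‖x - x'‖ + ‖t - t'‖) := by
            have := norm_nonneg (x - x')
            nlinarith
  refine ⟨R / 2, by positivity, ε, hε, γ, fun t ht x hx ↦ ⟨hγ0 t ht x hx, fun τ hτ ↦
    ⟨(hR₀s (hball (hγmem t ht x hx τ))).1.1, hγd t ht x hx τ hτ⟩⟩, ?_, ?_⟩
  · intro t ht t' ht' x hx x' hx'
    simpa using hest t ht t' ht' x hx x' hx' 1 (by simp)
  -- differentiability
  intro t₀ ht₀ x₀ hx₀
  have hn₀ : ‖t₀‖ ≤ ε := (mem_ball_zero_iff.1 ht₀).le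
  set c : ℝ → E := γ t₀ x₀ with hcdef
  have hc : ∀ τ, c τ ∈ closedBall e₀ R := hγmem t₀ ht₀ x₀ hx₀
  have hcc : ContinuousOn c (Icc 0 1) := fun τ hτ ↦
    (hγd t₀ ht₀ x₀ hx₀ τ (hsub hτ)).continuousAt.continuousWithinAt
  set Q : ℝ → E →L[ℝ] E := fun τ ↦ (fderiv ℝ g (c τ)).flip t₀ with hQdef
  have hQ : ∀ τ, ‖Q τ‖ ≤ 1 / 2 := fun τ ↦ by
    refine (ContinuousLinearMap.le_opNorm _ _).trans ?_
    rw [ContinuousLinearMap.opNorm_flip]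
    exact (mul_le_mul (hD _ (hc τ)) hn₀ (norm_nonneg _) hD0.le).trans hεD
  have hQc : ContinuousOn Q (Icc 0 1) := by
    have h1 : LipschitzOnWith (.mk L hL0.le) (fderiv ℝ g) (closedBall e₀ R) :=
      LipschitzOnWith.of_dist_le_mul fun x hx y hy ↦ by
        simpa only [dist_eq_norm, NNReal.coe_mk] using hlip' x hx y hy
    have h2 : ContinuousOn (fun τ ↦ fderiv ℝ g (c τ)) (Icc 0 1) :=
      h1.continuousOn.comp hcc fun τ _ ↦ hc τ
    exact (((ContinuousLinearMap.flipₗᵢ ℝ E V E).continuous.comp_continuousOn h2).clm_apply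
      continuousOn_const)
  have hgc : ContinuousOn (fun τ ↦ g (c τ)) (Icc 0 1) := fun τ hτ ↦
    (hdiff _ (hc τ)).continuousAt.comp_continuousWithinAt (hcc τ hτ)
  have hfst : ‖ContinuousLinearMap.fst ℝ V E‖ ≤ 1 := ContinuousLinearMap.norm_fst_le ℝ V E
  have hsnd : ‖ContinuousLinearMap.snd ℝ V E‖ ≤ 1 := ContinuousLinearMap.norm_snd_le ℝ V E
  -- `A` solves the variational equation along `c`; its value at time 1 is the candidate for the
  -- derivative of the time-one map.
  obtain ⟨A, hA0, hA⟩ : ∃ A : ℝ → (V × E →L[ℝ] E), A 0 = ContinuousLinearMap.snd ℝ V E ∧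
      ∀ τ ∈ Icc (0 : ℝ) 1, HasDerivWithinAt A
        ((g (c τ)).comp (ContinuousLinearMap.fst ℝ V E) + (Q τ).comp (A τ)) (Icc 0 1) τ := by
    -- The radius a = 2 * B + 1 solves B + (a + 1) / 2 = a, so the bound on the right-hand side over
    -- unit time is exactly the radius.
    have hpl : IsPicardLindelof
        (fun τ (A : V × E →L[ℝ] E) ↦
          (g (c τ)).comp (ContinuousLinearMap.fst ℝ V E) + (Q τ).comp A)
        (tmin := 0) (tmax := 1) ⟨0, by norm_num⟩ (ContinuousLinearMap.snd ℝ V E)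
        (.mk (2 * B + 1) (by positivity)) 0 (.mk (2 * B + 1) (by positivity))
        (.mk (1 / 2) (by positivity)) := by
      refine ⟨fun τ hτ ↦ ?_, fun A hA ↦ ?_, fun τ hτ A hA ↦ ?_, ?_⟩
      · refine LipschitzOnWith.of_dist_le_mul fun A _ A' _ ↦ ?_
        rw [dist_eq_norm, dist_eq_norm, add_sub_add_left_eq_sub, ← ContinuousLinearMap.comp_sub]
        refine (ContinuousLinearMap.opNorm_comp_le _ _).trans ?_
        exact mul_le_mul_of_nonneg_right (hQ τ) (norm_nonneg _)
      · exact (hgc.clm_comp continuousOn_const).add (hQc.clm_comp continuousOn_const)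
      · have hAn : ‖A‖ ≤ 2 * B + 1 + 1 := by
          have h1 : ‖A - ContinuousLinearMap.snd ℝ V E‖ ≤ 2 * B + 1 :=
            mem_closedBall_iff_norm.1 hA
          calc ‖A‖ = ‖(A - ContinuousLinearMap.snd ℝ V E) + ContinuousLinearMap.snd ℝ V E‖ := by
                rw [sub_add_cancel]
            _ ≤ _ := (norm_add_le _ _).trans (add_le_add h1 hsnd)
        refine (norm_add_le _ _).trans ?_
        have h1 : ‖(g (c τ)).comp (ContinuousLinearMap.fst ℝ V E)‖ ≤ B * 1 :=
          (ContinuousLinearMap.opNorm_comp_le _ _).trans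
            (mul_le_mul (hB _ (hc τ)) hfst (norm_nonneg _) hB0.le)
        have h2 : ‖(Q τ).comp A‖ ≤ 1 / 2 * (2 * B + 1 + 1) :=
          (ContinuousLinearMap.opNorm_comp_le _ _).trans
            (mul_le_mul (hQ τ) hAn (norm_nonneg _) (by norm_num))
        change _ ≤ 2 * B + 1
        linarith
      · simp only [sub_zero, sub_self]
        change (2 * B + 1) * max 1 0 ≤ (2 * B + 1) - 0
        norm_num
    exact hpl.exists_eq_forall_mem_Icc_hasDerivWithinAt₀
  -- the quadratic bound
  set C : ℝ := 2 * (1 + B + 2 * η) with hCdef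
  have hC0 : 0 < C := by positivity
  refine HasFDerivAt.differentiableAt (f' := A 1) ?_
  have hopen : (ball (0 : V) ε ×ˢ ball e₀ (R / 2)) ∈ 𝓝 (t₀, x₀) :=
    (isOpen_ball.prod isOpen_ball).mem_nhds ⟨ht₀, hx₀⟩
  have hquad : ∀ᶠ q : V × E in 𝓝 (t₀, x₀),
      ‖γ q.1 q.2 1 - γ t₀ x₀ 1 - A 1 (q - (t₀, x₀))‖
        ≤ (2 * (L * C + L * C ^ 2 * ε)) * ‖q - (t₀, x₀)‖ ^ 2 := by
    filter_upwards [hopen] with q hq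
    obtain ⟨t, x⟩ := q
    obtain ⟨ht, hx⟩ := hq
    set δ := ‖((t, x) : V × E) - (t₀, x₀)‖ with hδ
    have hδt : ‖t - t₀‖ ≤ δ := norm_fst_le (((t, x) : V × E) - (t₀, x₀))
    have hδx : ‖x - x₀‖ ≤ δ := norm_snd_le (((t, x) : V × E) - (t₀, x₀))
    have hδ0 : 0 ≤ δ := norm_nonneg _
    have hlipγ : ∀ τ ∈ Icc (0 : ℝ) 1, ‖γ t x τ - c τ‖ ≤ C * δ := by
      intro τ hτ
      have h1 := hest t ht t₀ ht₀ x hx x₀ hx₀ τ hτ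
      have h2 : ‖τ • g e₀ (t - t₀)‖ ≤ B * δ := by
        rw [norm_smul, Real.norm_eq_abs, abs_of_nonneg hτ.1]
        calc τ * ‖g e₀ (t - t₀)‖ ≤ 1 * (B * δ) := by
              refine mul_le_mul hτ.2 ((ContinuousLinearMap.le_opNorm _ _).trans
                (mul_le_mul (hB e₀ he₀) hδt (norm_nonneg _) hB0.le)) (norm_nonneg _) zero_le_one
          _ = B * δ := one_mul _
      have h3 : γ t x τ - c τ = (γ t x τ - γ t₀ x₀ τ - (x - x₀) - τ • g e₀ (t - t₀)) + (x - x₀)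
          + τ • g e₀ (t - t₀) := by rw [hcdef]; abel
      rw [h3]
      calc _ ≤ η * (‖x - x₀‖ + ‖t - t₀‖) + ‖x - x₀‖ + B * δ :=
            (norm_add_le _ _).trans (add_le_add ((norm_add_le _ _).trans
              (add_le_add h1 le_rfl)) h2)
        _ ≤ η * (δ + δ) + δ + B * δ := by gcongr
        _ ≤ C * δ := by rw [hCdef]; nlinarith [mul_nonneg hB0.le hδ0, mul_nonneg hη.le hδ0]
    have := norm_le_two_mul_of_norm_deriv_le
      (f := fun τ ↦ γ t x τ - c τ - A τ (t - t₀, x - x₀))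
      (f' := fun τ ↦ g (γ t x τ) t - g (c τ) t₀ -
        ((g (c τ)).comp (ContinuousLinearMap.fst ℝ V E) + (Q τ).comp (A τ)) (t - t₀, x - x₀))
      (c := (L * C + L * C ^ 2 * ε) * δ ^ 2) (by positivity)
      (by simp [hγ0 t ht x hx, hcdef, hγ0 t₀ ht₀ x₀ hx₀, hA0])
      (fun σ hσ ↦ ((hγd t ht x hx σ (hsub hσ)).hasDerivWithinAt.sub
        (hγd t₀ ht₀ x₀ hx₀ σ (hsub hσ)).hasDerivWithinAt).sub
          ((ContinuousLinearMap.apply ℝ E (t - t₀, x - x₀)).hasFDerivAt.comp_hasDerivWithinAt σ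
            (hA σ hσ)))
      (fun σ hσ ↦ ?_) 1 (by simp)
    · calc _ ≤ _ := this
        _ = _ := by ring
    · set y := γ t x σ
      have hy : y ∈ closedBall e₀ R := hγmem t ht x hx σ
      have hyc := hlipγ σ hσ
      set Δ := y - c σ - A σ (t - t₀, x - x₀) with hΔ
      -- The first term feeds Grönwall's inequality. The others are quadratic in δ: a product of two
      -- increments, and the Taylor remainder of g.
      have e1 : g y t - g (c σ) t₀ - ((g (c σ)).comp (ContinuousLinearMap.fst ℝ V E) +
            (Q σ).comp (A σ)) (t - t₀, x - x₀)
          = Q σ Δ + (g y - g (c σ)) (t - t₀)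
            + (g y - g (c σ) - fderiv ℝ g (c σ) (y - c σ)) t₀ := by
        simp only [hQdef, hΔ, ContinuousLinearMap.flip_apply, sub_apply, map_sub,
          ContinuousLinearMap.comp_apply, add_apply,
          ContinuousLinearMap.coe_fst']
        abel
      have n1 : ‖Q σ Δ‖ ≤ 1 * ‖Δ‖ := (ContinuousLinearMap.le_opNorm _ _).trans (by
        gcongr; linarith [hQ σ])
      have n2 : ‖(g y - g (c σ)) (t - t₀)‖ ≤ L * (C * δ) * δ :=
        (ContinuousLinearMap.le_opNorm _ _).trans (by
          gcongr
          exact (hlip y hy _ (hc σ)).trans (by gcongr))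
      have n3 : ‖(g y - g (c σ) - fderiv ℝ g (c σ) (y - c σ)) t₀‖ ≤ L * (C * δ) ^ 2 * ε :=
        (ContinuousLinearMap.le_opNorm _ _).trans (by
          gcongr
          exact (norm_sub_sub_le_of_lipschitz_deriv (convex_closedBall e₀ R) hdiff hlip' hL0.le
            (hc σ) hy).trans (by gcongr))
      rw [e1]
      calc _ ≤ 1 * ‖Δ‖ + L * (C * δ) * δ + L * (C * δ) ^ 2 * ε :=
            (norm_add_le _ _).trans (add_le_add ((norm_add_le _ _).trans (add_le_add n1 n2)) n3)
        _ = ‖Δ‖ + (L * C + L * C ^ 2 * ε) * δ ^ 2 := by ring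
  rw [hasFDerivAt_iff_isLittleO]
  have hO : (fun q : V × E ↦ γ q.1 q.2 1 - γ t₀ x₀ 1 - A 1 (q - (t₀, x₀))) =O[𝓝 (t₀, x₀)]
      fun q ↦ ‖q - (t₀, x₀)‖ ^ 2 :=
    Asymptotics.IsBigO.of_bound _ (hquad.mono fun q hq ↦ by rwa [norm_pow, norm_norm])
  refine hO.trans_isLittleO ?_
  have h1 : (fun q : V × E ↦ ‖q - (t₀, x₀)‖) =o[𝓝 (t₀, x₀)] (fun _ ↦ (1 : ℝ)) := by
    rw [Asymptotics.isLittleO_one_iff]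
    exact (tendsto_norm_sub_self (t₀, x₀))
  have h2 := h1.mul_isBigO (Asymptotics.isBigO_refl (fun q : V × E ↦ ‖q - (t₀, x₀)‖) _)
  simp only [one_mul, ← sq] at h2
  exact h2.of_norm_right

end LocalFlow

theorem Finset.exists_pos_forall_le {ι : Type*} (s : Finset ι) {f : ι → ℝ} (hf : ∀ i, 0 < f i) :
    ∃ ε > 0, ∀ i ∈ s, ε ≤ f i := by
  classical
  induction s using Finset.induction_on with
  | empty => exact ⟨1, one_pos, by simp⟩
  | insert a s _ ih =>
    obtain ⟨ε, hε, h⟩ := ih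
    refine ⟨min (f a) ε, lt_min (hf a) hε, fun i hi ↦ ?_⟩
    rcases Finset.mem_insert.1 hi with rfl | hi
    · exact min_le_left _ _
    · exact (min_le_right _ _).trans (h i hi)

/-! ### Time-one maps on the manifold, read in charts -/

section ManifoldFlow

open Metric Set

variable {m : ℕ} {M : Type*} [TopologicalSpace M] [ChartedSpace (EuclideanSpace ℝ (Fin m)) M]
  [IsManifold (𝓡 m) ∞ M] {V : Type*} [NormedAddCommGroup V] [InnerProductSpace ℝ V]

/-- The vector fields `X t` in the chart at `p`, as a linear function of `t`. -/
noncomputable def chartField [FiniteDimensional ℝ V]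
    (X : V →ₗ[ℝ] Cₛ^∞⟮𝓡 m; EuclideanSpace ℝ (Fin m), (TangentSpace (𝓡 m) : M → Type _)⟯)
    (p : M) (e : EuclideanSpace ℝ (Fin m)) : V →L[ℝ] EuclideanSpace ℝ (Fin m) :=
  LinearMap.toContinuousLinearMap
    { toFun := fun t ↦ tangentCoordChange (𝓡 m) ((extChartAt (𝓡 m) p).symm e) p
        ((extChartAt (𝓡 m) p).symm e) (X t ((extChartAt (𝓡 m) p).symm e))
      map_add' := fun t t' ↦ by
        rw [map_add X, ContMDiffSection.coe_add, Pi.add_apply]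
        exact map_add (tangentCoordChange (𝓡 m) ((extChartAt (𝓡 m) p).symm e) p
          ((extChartAt (𝓡 m) p).symm e)) _ _
      map_smul' := fun a t ↦ by
        rw [map_smul X, ContMDiffSection.coe_smul, Pi.smul_apply]
        exact map_smul (tangentCoordChange (𝓡 m) ((extChartAt (𝓡 m) p).symm e) p
          ((extChartAt (𝓡 m) p).symm e)) _ _ }

variable [FiniteDimensional ℝ V]
  (X : V →ₗ[ℝ] Cₛ^∞⟮𝓡 m; EuclideanSpace ℝ (Fin m), (TangentSpace (𝓡 m) : M → Type _)⟯)

theorem chartField_apply (p : M) (e : EuclideanSpace ℝ (Fin m)) (t : V) :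
    chartField X p e t = tangentCoordChange (𝓡 m) ((extChartAt (𝓡 m) p).symm e) p
        ((extChartAt (𝓡 m) p).symm e) (X t ((extChartAt (𝓡 m) p).symm e)) := rfl

theorem chartField_extChartAt {p x : M} (hx : x ∈ (extChartAt (𝓡 m) p).source) (t : V) :
    chartField X p (extChartAt (𝓡 m) p x) t = tangentCoordChange (𝓡 m) x p x (X t x) := by
  rw [chartField_apply, (extChartAt (𝓡 m) p).left_inv hx]

/-- For fixed t this is the fibre component of a smooth section in the trivialization at p. As V is
finite-dimensional, smoothness in operator norm can be checked on a basis. -/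
theorem contDiffAt_chartField (p : M) :
    ContDiffAt ℝ ∞ (chartField X p) (extChartAt (𝓡 m) p p) := by
  have h1 : ∀ t : V, ContDiffAt ℝ ∞ (fun e ↦ chartField X p e t) (extChartAt (𝓡 m) p p) := by
    intro t
    have hv := (X t).contMDiff.contMDiffAt (x := p)
    rw [contMDiffAt_iff] at hv
    exact (hv.2.contDiffAt (range_mem_nhds_isInteriorPoint
      (BoundarylessManifold.isInteriorPoint (I := 𝓡 m)))).snd
  set b := Module.finBasis ℝ V
  have h2 : chartField X p = fun e ↦ ∑ i,
      (LinearMap.toContinuousLinearMap (b.coord i)).smulRight (chartField X p e (b i)) := by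
    funext e
    ext1 t
    conv_lhs => rw [← b.sum_repr t, map_sum]
    simp
  rw [h2]
  refine ContDiffAt.sum fun i _ ↦ ?_
  exact contDiffAt_const.smulRight (h1 (b i))

omit [IsManifold (𝓡 m) ∞ M] in
/-- The derivative of a curve, in terms of the chart at the point. -/
theorem hasMFDerivAt_iff_hasDerivAt_extChartAt_self {c : ℝ → M} {τ : ℝ} (hc : ContinuousAt c τ)
    (w : EuclideanSpace ℝ (Fin m)) :
    HasMFDerivAt 𝓘(ℝ, ℝ) (𝓡 m) c τ ((1 : ℝ →L[ℝ] ℝ).smulRight w) ↔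
      HasDerivAt (extChartAt (𝓡 m) (c τ) ∘ c) w τ := by
  have h1 : (1 : ℝ →L[ℝ] ℝ).smulRight w = ContinuousLinearMap.toSpanSingleton ℝ w := by
    ext; simp
  rw [hasDerivAt_iff_hasFDerivAt, ← h1]
  constructor
  · intro h
    have h2 := h.2
    simp only [mfld_simps] at h2
    exact hasFDerivWithinAt_univ.1 h2
  · intro h
    refine ⟨hc, ?_⟩
    simp only [mfld_simps]
    exact hasFDerivWithinAt_univ.2 h

/-- The derivative of a curve, in terms of any chart. -/
theorem hasMFDerivAt_iff_hasDerivAt_extChartAt {c : ℝ → M} {τ : ℝ} (hc : ContinuousAt c τ) {p : M}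
    (hp : c τ ∈ (extChartAt (𝓡 m) p).source) (w : EuclideanSpace ℝ (Fin m)) :
    HasMFDerivAt 𝓘(ℝ, ℝ) (𝓡 m) c τ ((1 : ℝ →L[ℝ] ℝ).smulRight w) ↔
      HasDerivAt (extChartAt (𝓡 m) p ∘ c) (tangentCoordChange (𝓡 m) (c τ) p (c τ) w) τ := by
  have hxx := mem_extChartAt_source (I := 𝓡 m) (c τ)
  have key : ∀ q q' : M, c τ ∈ (extChartAt (𝓡 m) q).source → c τ ∈ (extChartAt (𝓡 m) q').source →
      ∀ w : EuclideanSpace ℝ (Fin m), HasDerivAt (extChartAt (𝓡 m) q ∘ c) w τ →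
      HasDerivAt (extChartAt (𝓡 m) q' ∘ c) (tangentCoordChange (𝓡 m) q q' (c τ) w) τ := by
    intro q q' hq hq' w h
    have h1 : HasFDerivAt (extChartAt (𝓡 m) q' ∘ (extChartAt (𝓡 m) q).symm)
        (tangentCoordChange (𝓡 m) q q' (c τ)) ((extChartAt (𝓡 m) q ∘ c) τ) :=
      (hasFDerivWithinAt_tangentCoordChange ⟨hq, hq'⟩).hasFDerivAt (by simp)
    refine (h1.comp_hasDerivAt τ h).congr_of_eventuallyEq ?_
    filter_upwards [hc.preimage_mem_nhds (extChartAt_source_mem_nhds' hq)] with σ hσ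
    simp only [Function.comp_apply]
    rw [(extChartAt (𝓡 m) q).left_inv hσ]
  rw [hasMFDerivAt_iff_hasDerivAt_extChartAt_self hc]
  refine ⟨key _ _ hxx hp w, fun h ↦ ?_⟩
  have := key _ _ hp hxx _ h
  rwa [tangentCoordChange_comp ⟨⟨hxx, hp⟩, hxx⟩, tangentCoordChange_self hxx] at this

/-- Solutions of the differential equation in a chart are integral curves on the manifold. -/
theorem hasMFDerivAt_extChartAt_symm_comp {p : M} {t : V} {c : ℝ → EuclideanSpace ℝ (Fin m)} {τ : ℝ}
    (hc : HasDerivAt c (chartField X p (c τ) t) τ) (hτ : c τ ∈ (extChartAt (𝓡 m) p).target) :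
    HasMFDerivAt 𝓘(ℝ, ℝ) (𝓡 m) ((extChartAt (𝓡 m) p).symm ∘ c) τ
      ((1 : ℝ →L[ℝ] ℝ).smulRight (X t (((extChartAt (𝓡 m) p).symm ∘ c) τ))) := by
  have hcont : ContinuousAt ((extChartAt (𝓡 m) p).symm ∘ c) τ :=
    (continuousAt_extChartAt_symm'' hτ).comp hc.continuousAt
  refine (hasMFDerivAt_iff_hasDerivAt_extChartAt hcont
    ((extChartAt (𝓡 m) p).map_target hτ) _).2 (hc.congr_of_eventuallyEq ?_)
  filter_upwards [hc.continuousAt.preimage_mem_nhds ((isOpen_extChartAt_target p).mem_nhds hτ)] with σ hσ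
  exact (extChartAt (𝓡 m) p).right_inv hσ

omit [FiniteDimensional ℝ V] in
theorem contMDiff_one_vectorField (t : V) :
    ContMDiff (𝓡 m) (𝓡 m).tangent 1 (fun x ↦ (⟨x, X t x⟩ : TangentBundle (𝓡 m) M)) :=
  (X t).contMDiff.of_le (by norm_num)

/-- The flows of the vector fields `X t` near `p`, for small `t`, in the chart at `p`. -/
theorem exists_chart_flow (p : M) {η : ℝ} (hη : 0 < η) {O' : Set M} (hO' : O' ∈ 𝓝 p) :
    ∃ O ∈ 𝓝 p, O ⊆ (extChartAt (𝓡 m) p).source ∧ ∃ ε > 0,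
      ∃ γ : V → EuclideanSpace ℝ (Fin m) → ℝ → EuclideanSpace ℝ (Fin m),
      (∀ t ∈ ball (0 : V) ε, ∀ x ∈ O,
        (extChartAt (𝓡 m) p).symm (γ t (extChartAt (𝓡 m) p x) 0) = x ∧
        (∀ τ ∈ Ioo (-2 : ℝ) 2, γ t (extChartAt (𝓡 m) p x) τ ∈ (extChartAt (𝓡 m) p).target ∧
          (extChartAt (𝓡 m) p).symm (γ t (extChartAt (𝓡 m) p x) τ) ∈ O') ∧
        IsMIntegralCurveOn ((extChartAt (𝓡 m) p).symm ∘ γ t (extChartAt (𝓡 m) p x)) (X t)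
          (Ioo (-2) 2)) ∧
      (∀ t ∈ ball (0 : V) ε, ∀ t' ∈ ball (0 : V) ε, ∀ x ∈ O, ∀ x' ∈ O,
        ‖γ t (extChartAt (𝓡 m) p x) 1 - γ t' (extChartAt (𝓡 m) p x') 1
          - (extChartAt (𝓡 m) p x - extChartAt (𝓡 m) p x')
          - chartField X p (extChartAt (𝓡 m) p p) (t - t')‖
          ≤ η * (‖extChartAt (𝓡 m) p x - extChartAt (𝓡 m) p x'‖ + ‖t - t'‖)) ∧
      (∀ t ∈ ball (0 : V) ε, ∀ x ∈ O,
        DifferentiableAt ℝ (fun q : V × EuclideanSpace ℝ (Fin m) ↦ γ q.1 q.2 1)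
          (t, extChartAt (𝓡 m) p x)) := by
  have hs : (extChartAt (𝓡 m) p).target ∩ (extChartAt (𝓡 m) p).symm ⁻¹' O' ∈
      𝓝 (extChartAt (𝓡 m) p p) := by
    refine Filter.inter_mem (extChartAt_target_mem_nhds p) ?_
    exact (continuousAt_extChartAt_symm p).preimage_mem_nhds (by simpa using hO')
  obtain ⟨r, hr, ε, hε, γ, h1, h2, h3⟩ := exists_local_flow
    ((contDiffAt_chartField X p).of_le ENat.LEInfty.out) hη hs
  refine ⟨(extChartAt (𝓡 m) p).source ∩ extChartAt (𝓡 m) p ⁻¹' ball (extChartAt (𝓡 m) p p) r,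
    Filter.inter_mem (extChartAt_source_mem_nhds p)
      ((continuousAt_extChartAt p).preimage_mem_nhds (ball_mem_nhds _ hr)), inter_subset_left,
    ε, hε, γ, fun t ht x hx ↦ ⟨?_, fun τ hτ ↦ ((h1 t ht _ hx.2).2 τ hτ).1, fun τ hτ ↦ ?_⟩,
    fun t ht t' ht' x hx x' hx' ↦ h2 t ht t' ht' _ hx.2 _ hx'.2, fun t ht x hx ↦ h3 t ht _ hx.2⟩
  · rw [(h1 t ht _ hx.2).1, (extChartAt (𝓡 m) p).left_inv hx.1]
  · obtain ⟨hmem, hd⟩ := (h1 t ht _ hx.2).2 τ hτ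
    exact (hasMFDerivAt_extChartAt_symm_comp X hd hmem.1).hasMFDerivWithinAt

variable [T2Space M]

omit [FiniteDimensional ℝ V] in
theorem timeOneMap_eq_of_isMIntegralCurve {t : V} {x : M} (h : ∃ γ : ℝ → M, γ 0 = x ∧
    IsMIntegralCurve γ (X t)) {c : ℝ → M} (h0 : c 0 = x)
    (hc : IsMIntegralCurveOn c (X t) (Ioo (-2) 2)) : timeOneMap (X t) x = c 1 := by
  rw [timeOneMap, dif_pos h]
  exact isMIntegralCurveOn_Ioo_eqOn_of_contMDiff_boundaryless (t₀ := 0) (a := -2) (b := 2)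
    (by norm_num) (contMDiff_one_vectorField X t) (h.choose_spec.2.isMIntegralCurveOn _) hc
    (by rw [h.choose_spec.1, h0]) (by norm_num)

/-- On a compact manifold, the integral curves of the fields `X t` with small `t` are complete. -/
theorem exists_pos_forall_exists_isMIntegralCurve [CompactSpace M] :
    ∃ ε > 0, ∀ t ∈ ball (0 : V) ε, ∀ x : M, ∃ γ : ℝ → M, γ 0 = x ∧ IsMIntegralCurve γ (X t) := by
  have hloc : ∀ p : M, ∃ O ∈ 𝓝 p, ∃ ε > 0, ∀ t ∈ ball (0 : V) ε, ∀ x ∈ O, ∃ γ : ℝ → M, γ 0 = x ∧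
      IsMIntegralCurveOn γ (X t) (Ioo (-2) 2) := by
    intro p
    obtain ⟨O, hO, -, ε, hε, γ, h, -⟩ := exists_chart_flow X p one_pos Filter.univ_mem
    exact ⟨O, hO, ε, hε, fun t ht x hx ↦ ⟨_, (h t ht x hx).1, (h t ht x hx).2.2⟩⟩
  choose O hO ε hε h using hloc
  obtain ⟨s, hs⟩ := CompactSpace.elim_nhds_subcover O hO
  obtain ⟨δ, hδ, hle⟩ := s.exists_pos_forall_le hε
  -- An existence time common to all initial points lets the local curves be continued to all of ℝ.
  refine ⟨δ, hδ, fun t ht ↦ exists_isMIntegralCurve_of_isMIntegralCurveOn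
    (contMDiff_one_vectorField X t) two_pos fun x ↦ ?_⟩
  have hx : x ∈ ⋃ p ∈ s, O p := hs ▸ mem_univ x
  obtain ⟨p, hp, hxp⟩ := mem_iUnion₂.1 hx
  exact h p t (ball_subset_ball (hle p hp) ht) x hxp

/-- The time-one maps of small vector fields `X t` near a point `p`, in the chart at `p`: the map
`(t, x) ↦ timeOneMap (X t) x` is differentiable and is strictly approximated at `(0, p)` by its
linearization. -/
theorem exists_timeOneMap_chart [CompactSpace M] (p : M) {η : ℝ} (hη : 0 < η) {O' : Set M}
    (hO' : O' ∈ 𝓝 p) :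
    ∃ O ∈ 𝓝 p, O ⊆ (extChartAt (𝓡 m) p).source ∧ ∃ ε > 0,
      ∃ Φ : V × EuclideanSpace ℝ (Fin m) → EuclideanSpace ℝ (Fin m),
      (∀ t ∈ ball (0 : V) ε, ∀ x ∈ O,
        timeOneMap (X t) x ∈ (extChartAt (𝓡 m) p).source ∧ timeOneMap (X t) x ∈ O' ∧
        extChartAt (𝓡 m) p (timeOneMap (X t) x) = Φ (t, extChartAt (𝓡 m) p x) ∧
        DifferentiableAt ℝ Φ (t, extChartAt (𝓡 m) p x)) ∧
      (∀ t ∈ ball (0 : V) ε, ∀ t' ∈ ball (0 : V) ε, ∀ x ∈ O, ∀ x' ∈ O,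
        ‖Φ (t, extChartAt (𝓡 m) p x) - Φ (t', extChartAt (𝓡 m) p x')
          - (extChartAt (𝓡 m) p x - extChartAt (𝓡 m) p x')
          - chartField X p (extChartAt (𝓡 m) p p) (t - t')‖
          ≤ η * (‖extChartAt (𝓡 m) p x - extChartAt (𝓡 m) p x'‖ + ‖t - t'‖)) := by
  obtain ⟨ε₁, hε₁, hcomp⟩ := exists_pos_forall_exists_isMIntegralCurve X
  obtain ⟨O, hO, hOs, ε₂, hε₂, γ, h1, h2, h3⟩ := exists_chart_flow X p hη hO'
  refine ⟨O, hO, hOs, min ε₁ ε₂, lt_min hε₁ hε₂, fun q ↦ γ q.1 q.2 1, fun t ht x hx ↦ ?_,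
    fun t ht t' ht' ↦ h2 t (ball_subset_ball (min_le_right _ _) ht) t'
      (ball_subset_ball (min_le_right _ _) ht')⟩
  have ht₁ := ball_subset_ball (min_le_left _ _) ht
  have ht₂ := ball_subset_ball (min_le_right _ _) ht
  obtain ⟨h0, hmem, hint⟩ := h1 t ht₂ x hx
  obtain ⟨htar, hmem'⟩ := hmem 1 (by norm_num)
  have he : timeOneMap (X t) x = (extChartAt (𝓡 m) p).symm (γ t (extChartAt (𝓡 m) p x) 1) :=
    timeOneMap_eq_of_isMIntegralCurve X (hcomp t ht₁ x) h0 hint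
  rw [he]
  exact ⟨(extChartAt (𝓡 m) p).map_target htar, hmem', (extChartAt (𝓡 m) p).right_inv htar,
    h3 t ht₂ x hx⟩

end ManifoldFlow

/-! ### Tangent spaces of subsets in charts -/

section Tangent

open Metric Set

/-- `T` is the tangent space at `x` of the subset `A` of a Euclidean space: the vectors of `T` are
velocities of curves in `A`, and the secants of `A` near `x` are close to `T`. -/
structure HasTangentSpace {E : Type*} [NormedAddCommGroup E] [NormedSpace ℝ E]
    (A : Set E) (x : E) (T : Submodule ℝ E) : Prop where
  exists_curve : ∀ u ∈ T, ∃ c : ℝ → E, c 0 = x ∧ (∀ᶠ s in 𝓝 0, c s ∈ A) ∧ HasDerivAt c u 0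
  exists_nhds : ∀ η > 0, ∃ O ∈ 𝓝 x, ∀ y ∈ A ∩ O, ∀ y' ∈ A ∩ O, ∃ u ∈ T,
    ‖y' - y - u‖ ≤ η * ‖y' - y‖

/-- Projecting to the orthogonal complement of T kills the unspecified nearby vector u in the secant
condition. What remains is a little-o statement that can be composed with curves and
parametrizations. -/
theorem HasTangentSpace.isLittleO_starProjection {E : Type*} [NormedAddCommGroup E]
    [InnerProductSpace ℝ E] [FiniteDimensional ℝ E] {A : Set E} {x : E} {T : Submodule ℝ E}
    (h : HasTangentSpace A x T) (hx : x ∈ A) :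
    (fun y ↦ Tᗮ.starProjection (y - x)) =o[𝓝[A] x] fun y ↦ y - x := by
  rw [Asymptotics.isLittleO_iff]
  intro η hη
  obtain ⟨O, hO, hAO⟩ := h.exists_nhds η hη
  filter_upwards [self_mem_nhdsWithin, mem_nhdsWithin_of_mem_nhds hO] with y hyA hyO
  obtain ⟨u, hu, hle⟩ := hAO x ⟨hx, mem_of_mem_nhds hO⟩ y ⟨hyA, hyO⟩
  have h1 : Tᗮ.starProjection u = 0 :=
    (Submodule.starProjection_apply_eq_zero_iff _).2 (by simpa using hu)
  calc ‖Tᗮ.starProjection (y - x)‖ = ‖Tᗮ.starProjection (y - x - u)‖ := by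
        rw [map_sub _ (y - x) u, h1, sub_zero]
    _ ≤ ‖y - x - u‖ := Submodule.norm_starProjection_apply_le _ _
    _ ≤ _ := hle

/-- Velocities of curves in `A` belong to the tangent space. -/
theorem HasTangentSpace.mem_of_hasDerivAt {E : Type*} [NormedAddCommGroup E]
    [InnerProductSpace ℝ E] [FiniteDimensional ℝ E] {A : Set E} {x : E} {T : Submodule ℝ E}
    (h : HasTangentSpace A x T) (hx : x ∈ A) {c : ℝ → E} {u : E} (h0 : c 0 = x)
    (hc : ∀ᶠ s in 𝓝 0, c s ∈ A) (hd : HasDerivAt c u 0) : u ∈ T := by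
  have ht : Filter.Tendsto c (𝓝 0) (𝓝[A] x) :=
    tendsto_nhdsWithin_iff.2 ⟨h0 ▸ hd.continuousAt, hc⟩
  -- The normal component of the curve is o(s), so its derivative at 0, the normal component of u,
  -- vanishes.
  have h1 : (fun s ↦ Tᗮ.starProjection (c s - x)) =o[𝓝 0] fun s : ℝ ↦ s - 0 :=
    ((h.isLittleO_starProjection hx).comp_tendsto ht).trans_isBigO
      (by simpa [h0, Function.comp_def] using hd.isBigO_sub)
  have h2 : HasDerivAt (fun s ↦ Tᗮ.starProjection (c s - x)) 0 0 := by
    rw [hasDerivAt_iff_isLittleO]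
    simpa [h0] using h1
  have h3 : HasDerivAt (fun s ↦ Tᗮ.starProjection (c s - x)) (Tᗮ.starProjection u) 0 :=
    Tᗮ.starProjection.hasFDerivAt.comp_hasDerivAt 0 (hd.sub_const x)
  have h4 := h3.unique h2
  rw [Submodule.starProjection_apply_eq_zero_iff] at h4
  simpa using h4

variable {m : ℕ} {M : Type*} [TopologicalSpace M] [ChartedSpace (EuclideanSpace ℝ (Fin m)) M]
  [IsManifold (𝓡 m) ∞ M]

theorem tangentCoordChange_tangentCoordChange {x p : M} (hx : x ∈ (extChartAt (𝓡 m) p).source)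
    (w : EuclideanSpace ℝ (Fin m)) :
    tangentCoordChange (𝓡 m) p x x (tangentCoordChange (𝓡 m) x p x w) = w := by
  have hxx := mem_extChartAt_source (I := 𝓡 m) x
  rw [tangentCoordChange_comp ⟨⟨hxx, hx⟩, hxx⟩, tangentCoordChange_self hxx]

theorem tangentCoordChange_tangentCoordChange' {x p : M} (hx : x ∈ (extChartAt (𝓡 m) p).source)
    (w : EuclideanSpace ℝ (Fin m)) :
    tangentCoordChange (𝓡 m) x p x (tangentCoordChange (𝓡 m) p x x w) = w := by
  have hxx := mem_extChartAt_source (I := 𝓡 m) x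
  rw [tangentCoordChange_comp ⟨⟨hx, hxx⟩, hx⟩, tangentCoordChange_self hx]

/-- Velocities of curves in the chart image of `S` belong to the tangent space of `S`. -/
theorem mem_tangentSpaceOfSet_of_hasDerivAt {S : Set M} {x p : M}
    (hx : x ∈ (extChartAt (𝓡 m) p).source) {c : ℝ → EuclideanSpace ℝ (Fin m)}
    {w : EuclideanSpace ℝ (Fin m)} (h0 : c 0 = extChartAt (𝓡 m) p x)
    (hc : ∀ᶠ s in 𝓝 0, (extChartAt (𝓡 m) p).symm (c s) ∈ S)
    (hd : HasDerivAt c (tangentCoordChange (𝓡 m) x p x w) 0) :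
    w ∈ tangentSpaceOfSet (m := m) S x := by
  have h0' : (extChartAt (𝓡 m) p).symm (c 0) = x := by rw [h0, (extChartAt (𝓡 m) p).left_inv hx]
  have htar : c 0 ∈ (extChartAt (𝓡 m) p).target := h0 ▸ (extChartAt (𝓡 m) p).map_source hx
  have hcont : ContinuousAt ((extChartAt (𝓡 m) p).symm ∘ c) 0 :=
    (continuousAt_extChartAt_symm'' htar).comp hd.continuousAt
  refine Submodule.subset_span ⟨(extChartAt (𝓡 m) p).symm ∘ c, h0', hc, ?_⟩
  subst h0'
  refine (hasMFDerivAt_iff_hasDerivAt_extChartAt hcont hx w).2 (hd.congr_of_eventuallyEq ?_)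
  filter_upwards [hd.continuousAt.preimage_mem_nhds
    ((isOpen_extChartAt_target p).mem_nhds htar)] with σ hσ
  exact (extChartAt (𝓡 m) p).right_inv hσ

/-- The set `S` in the chart at `p`. -/
def chartImage (p : M) (S : Set M) : Set (EuclideanSpace ℝ (Fin m)) :=
  (extChartAt (𝓡 m) p).target ∩ (extChartAt (𝓡 m) p).symm ⁻¹' S

omit [IsManifold (𝓡 m) ∞ M] in
theorem extChartAt_mem_chartImage {p x : M} {S : Set M} (hx : x ∈ (extChartAt (𝓡 m) p).source)
    (hxS : x ∈ S) : extChartAt (𝓡 m) p x ∈ chartImage (m := m) p S :=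
  ⟨(extChartAt (𝓡 m) p).map_source hx, by
    rwa [mem_preimage, (extChartAt (𝓡 m) p).left_inv hx]⟩

/-- The tangent space of `S`, in the chart at `p`. -/
theorem HasTangentSpace.mem_tangentSpaceOfSet_iff {S : Set M} {x p : M}
    (hx : x ∈ (extChartAt (𝓡 m) p).source) (hxS : x ∈ S)
    {T : Submodule ℝ (EuclideanSpace ℝ (Fin m))}
    (hT : HasTangentSpace (chartImage (m := m) p S) (extChartAt (𝓡 m) p x) T)
    (w : TangentSpace (𝓡 m) x) :
    w ∈ tangentSpaceOfSet (m := m) S x ↔ tangentCoordChange (𝓡 m) x p x w ∈ T := by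
  constructor
  · intro hw
    change w ∈ T.comap (tangentCoordChange (𝓡 m) x p x).toLinearMap
    revert w
    change tangentSpaceOfSet (m := m) S x ≤ T.comap (tangentCoordChange (𝓡 m) x p x).toLinearMap
    refine Submodule.span_le.2 ?_
    rintro w ⟨γ, rfl, hγS, hγ⟩
    have hd := (hasMFDerivAt_iff_hasDerivAt_extChartAt hγ.continuousAt hx w).1 hγ
    refine hT.mem_of_hasDerivAt (extChartAt_mem_chartImage hx hxS) rfl ?_ hd
    filter_upwards [hγS, hγ.continuousAt.preimage_mem_nhds
      ((isOpen_extChartAt_source p).mem_nhds hx)] with s hs hs'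
    exact extChartAt_mem_chartImage hs' hs
  · intro hw
    obtain ⟨c, h0, hc, hd⟩ := hT.exists_curve _ hw
    exact mem_tangentSpaceOfSet_of_hasDerivAt hx h0 (hc.mono fun s hs ↦ hs.2) hd

/-- Transition maps between the chart at `p` and a chart of the maximal atlas are differentiable,
with mutually inverse derivatives. -/
theorem exists_hasStrictFDerivAt_transition {κ : OpenPartialHomeomorph M (EuclideanSpace ℝ (Fin m))}
    (hκ : κ ∈ IsManifold.maximalAtlas (𝓡 m) ∞ M) {p x : M}
    (hx : x ∈ (extChartAt (𝓡 m) p).source) (hxκ : x ∈ κ.source) :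
    ∃ ψ : EuclideanSpace ℝ (Fin m) ≃L[ℝ] EuclideanSpace ℝ (Fin m),
      HasStrictFDerivAt (extChartAt (𝓡 m) p ∘ κ.symm)
        (ψ : EuclideanSpace ℝ (Fin m) →L[ℝ] EuclideanSpace ℝ (Fin m)) (κ x) ∧
      HasStrictFDerivAt (κ ∘ (extChartAt (𝓡 m) p).symm)
        (ψ.symm : EuclideanSpace ℝ (Fin m) →L[ℝ] EuclideanSpace ℝ (Fin m))
        (extChartAt (𝓡 m) p x) := by
  set f := extChartAt (𝓡 m) p ∘ κ.symm
  set g := κ ∘ (extChartAt (𝓡 m) p).symm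
  have hf : ContDiffAt ℝ ∞ f (κ x) := by
    rw [← contMDiffAt_iff_contDiffAt]
    refine ContMDiffAt.comp (κ x) (I' := 𝓡 m) ?_
      (contMDiffAt_symm_of_mem_maximalAtlas hκ (κ.map_source hxκ))
    rw [κ.left_inv hxκ]
    exact contMDiffAt_extChartAt' (by rwa [extChartAt_source] at hx)
  have hg : ContDiffAt ℝ ∞ g (extChartAt (𝓡 m) p x) := by
    rw [← contMDiffAt_iff_contDiffAt]
    refine ContMDiffAt.comp (extChartAt (𝓡 m) p x) (I' := 𝓡 m) ?_
      ((contMDiffOn_extChartAt_symm p).contMDiffAt ((isOpen_extChartAt_target p).mem_nhds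
        ((extChartAt (𝓡 m) p).map_source hx)))
    rw [(extChartAt (𝓡 m) p).left_inv hx]
    exact contMDiffAt_of_mem_maximalAtlas hκ hxκ
  have hfx : f (κ x) = extChartAt (𝓡 m) p x := by simp [f, κ.left_inv hxκ]
  have hgx : g (extChartAt (𝓡 m) p x) = κ x := by
    simp only [g, Function.comp_apply]
    rw [(extChartAt (𝓡 m) p).left_inv hx]
  have hf' := hf.hasStrictFDerivAt (by simp)
  have hg' := hg.hasStrictFDerivAt (by simp)
  have h1 : f ∘ g =ᶠ[𝓝 (extChartAt (𝓡 m) p x)] id := by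
    filter_upwards [(isOpen_extChartAt_target p).mem_nhds ((extChartAt (𝓡 m) p).map_source hx),
      (continuousAt_extChartAt_symm' hx).preimage_mem_nhds (κ.open_source.mem_nhds (by
        rwa [(extChartAt (𝓡 m) p).left_inv hx]))] with y hy1 hy2
    simp only [f, g, Function.comp_apply, id]
    rw [κ.left_inv hy2, (extChartAt (𝓡 m) p).right_inv hy1]
  have h2 : g ∘ f =ᶠ[𝓝 (κ x)] id := by
    filter_upwards [κ.open_target.mem_nhds (κ.map_source hxκ),
      (κ.continuousAt_symm (κ.map_source hxκ)).preimage_mem_nhds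
        ((isOpen_extChartAt_source p).mem_nhds (by rwa [κ.left_inv hxκ]))] with y hy1 hy2
    simp only [f, g, Function.comp_apply, id]
    rw [(extChartAt (𝓡 m) p).left_inv hy2, κ.right_inv hy1]
  have e1 : (fderiv ℝ f (κ x)).comp (fderiv ℝ g (extChartAt (𝓡 m) p x)) = .id ℝ _ :=
    ((HasFDerivAt.comp _ (hgx ▸ hf'.hasFDerivAt) hg'.hasFDerivAt).congr_of_eventuallyEq
      h1.symm).unique (hasFDerivAt_id _)
  have e2 : (fderiv ℝ g (extChartAt (𝓡 m) p x)).comp (fderiv ℝ f (κ x)) = .id ℝ _ :=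
    ((HasFDerivAt.comp _ (hfx ▸ hg'.hasFDerivAt) hf'.hasFDerivAt).congr_of_eventuallyEq
      h2.symm).unique (hasFDerivAt_id _)
  exact ⟨ContinuousLinearEquiv.equivOfInverse (fderiv ℝ f (κ x))
    (fderiv ℝ g (extChartAt (𝓡 m) p x)) (fun v ↦ congr($e2 v)) (fun v ↦ congr($e1 v)), hf', hg'⟩

/-- S is the plane L in an adapted chart, and T is the image of L under the derivative of the
transition map. Lines in L give the curves. Strict differentiability of the inverse transition is
needed because both endpoints of the secants vary. -/
theorem IsEmbeddedSubmanifold.exists_hasTangentSpace {d : ℕ} {S : Set M}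
    (hS : IsEmbeddedSubmanifold (m := m) d S) {x p : M} (hxS : x ∈ S)
    (hx : x ∈ (extChartAt (𝓡 m) p).source) :
    ∃ T : Submodule ℝ (EuclideanSpace ℝ (Fin m)), Module.finrank ℝ T = d ∧
      HasTangentSpace (chartImage (m := m) p S) (extChartAt (𝓡 m) p x) T := by
  obtain ⟨κ, hκ, hxκ, L, hL, hSL⟩ := hS x hxS
  obtain ⟨ψ, hψ, hψ'⟩ := exists_hasStrictFDerivAt_transition hκ hx hxκ
  refine ⟨L.map (ψ : EuclideanSpace ℝ (Fin m) →ₗ[ℝ] EuclideanSpace ℝ (Fin m)), ?_, ?_, ?_⟩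
  · rw [← hL]
    exact LinearEquiv.finrank_map_eq ψ.toLinearEquiv L
  · rintro _ ⟨l, hl, rfl⟩
    have hline : HasDerivAt (fun s : ℝ ↦ κ x + s • l) l 0 := by
      simpa using ((hasDerivAt_id (0 : ℝ)).smul_const l).const_add (κ x)
    have hlc : ContinuousAt (fun s : ℝ ↦ κ x + s • l) 0 := hline.continuousAt
    have hl0 : κ x + (0 : ℝ) • l = κ x := by simp
    refine ⟨fun s ↦ extChartAt (𝓡 m) p (κ.symm (κ x + s • l)), by simp [κ.left_inv hxκ], ?_, ?_⟩
    · have h1 : ∀ᶠ s : ℝ in 𝓝 0, κ x + s • l ∈ κ.target :=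
        hlc.preimage_mem_nhds (κ.open_target.mem_nhds (by rw [hl0]; exact κ.map_source hxκ))
      have h2 : ∀ᶠ s : ℝ in 𝓝 0, κ.symm (κ x + s • l) ∈ (extChartAt (𝓡 m) p).source := by
        have h3 : ContinuousAt (fun s : ℝ ↦ κ.symm (κ x + s • l)) 0 :=
          ContinuousAt.comp (g := κ.symm) (by
            rw [hl0]; exact κ.continuousAt_symm (κ.map_source hxκ)) hlc
        exact h3.preimage_mem_nhds ((isOpen_extChartAt_source p).mem_nhds (by
          simpa [κ.left_inv hxκ] using hx))
      filter_upwards [h1, h2] with s hs1 hs2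
      refine extChartAt_mem_chartImage hs2 ((hSL _ (κ.map_target hs1)).2 ?_)
      rw [κ.right_inv hs1]
      exact L.add_mem ((hSL x hxκ).1 hxS) (L.smul_mem s hl)
    · have := hψ.hasFDerivAt.comp_hasDerivAt_of_eq (0 : ℝ) hline hl0.symm
      exact this
  · intro η hη
    obtain ⟨C, hC, hCψ⟩ : ∃ C > 0, ∀ v, ‖ψ v‖ ≤ C * ‖v‖ :=
      ⟨‖(ψ : EuclideanSpace ℝ (Fin m) →L[ℝ] EuclideanSpace ℝ (Fin m))‖ + 1, by positivity,
        fun v ↦ ((ψ : EuclideanSpace ℝ (Fin m) →L[ℝ] EuclideanSpace ℝ (Fin m)).le_opNorm v).trans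
          (by gcongr; linarith)⟩
    have h1 := hψ'.isLittleO.def (c := η / C) (by positivity)
    rw [nhds_prod_eq] at h1
    obtain ⟨O₁, hO₁, h1⟩ := Filter.mem_prod_same_iff.1 h1
    have hO₂ : (extChartAt (𝓡 m) p).symm ⁻¹' κ.source ∈ 𝓝 (extChartAt (𝓡 m) p x) :=
      (continuousAt_extChartAt_symm' hx).preimage_mem_nhds (κ.open_source.mem_nhds (by
        rwa [(extChartAt (𝓡 m) p).left_inv hx]))
    refine ⟨O₁ ∩ (extChartAt (𝓡 m) p).symm ⁻¹' κ.source, Filter.inter_mem hO₁ hO₂, ?_⟩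
    rintro y ⟨hyA, hy1, hy2⟩ y' ⟨hyA', hy1', hy2'⟩
    refine ⟨ψ (κ ((extChartAt (𝓡 m) p).symm y') - κ ((extChartAt (𝓡 m) p).symm y)),
      ⟨_, L.sub_mem ((hSL _ hy2').1 hyA'.2) ((hSL _ hy2).1 hyA.2), rfl⟩, ?_⟩
    have h2 := h1 (mk_mem_prod hy1' hy1)
    have h3 : y' - y - ψ (κ ((extChartAt (𝓡 m) p).symm y') - κ ((extChartAt (𝓡 m) p).symm y))
        = - ψ ((κ ∘ (extChartAt (𝓡 m) p).symm) y' - (κ ∘ (extChartAt (𝓡 m) p).symm) y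
          - ψ.symm (y' - y)) := by
      simp
    rw [h3, norm_neg]
    refine (hCψ _).trans ?_
    calc _ ≤ C * (η / C * ‖y' - y‖) := by gcongr; exact h2
      _ = η * ‖y' - y‖ := by field_simp

end Tangent

/-! ### Comparison of Riemannian and chart distances -/

section Riemannian

open Metric Set Manifold MeasureTheory

open scoped NNReal

attribute [local instance] normedAddCommGroupTangentSpaceVectorSpace
  normedSpaceTangentSpaceVectorSpace

variable {m : ℕ} {M : Type*} [EMetricSpace M]
  [ChartedSpace (EuclideanSpace ℝ (Fin m)) M] [IsManifold (𝓡 m) ∞ M]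
  [RiemannianBundle (fun x : M => TangentSpace (𝓡 m) x)]

theorem isContinuousRiemannianBundle_tangentSpace
    [h : IsContMDiffRiemannianBundle (𝓡 m) ∞ (EuclideanSpace ℝ (Fin m))
      (fun x : M => TangentSpace (𝓡 m) x)] :
    IsContinuousRiemannianBundle (EuclideanSpace ℝ (Fin m))
      (fun x : M => TangentSpace (𝓡 m) x) := by
  obtain ⟨g, hg, h⟩ := h.exists_contMDiff
  exact ⟨g, hg.continuous, h⟩

variable [IsContinuousRiemannianBundle (EuclideanSpace ℝ (Fin m))
    (fun x : M => TangentSpace (𝓡 m) x)]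

/-- Near `p`, the Riemannian norm is bounded by the norm in the chart at `p`. -/
theorem eventually_norm_le_norm_tangentCoordChange (p : M) :
    ∃ C > 0, ∀ᶠ x in 𝓝 p, ∀ w : TangentSpace (𝓡 m) x,
      ‖w‖ ≤ C * ‖tangentCoordChange (𝓡 m) x p x w‖ := by
  obtain ⟨C, hC, h⟩ := eventually_norm_symmL_trivializationAt_lt (EuclideanSpace ℝ (Fin m))
    (fun x : M => TangentSpace (𝓡 m) x) p
  refine ⟨C, hC, ?_⟩
  filter_upwards [h, extChartAt_source_mem_nhds (I := 𝓡 m) p] with x hx hxs w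
  have h1 := ((trivializationAt (EuclideanSpace ℝ (Fin m))
    (fun x : M => TangentSpace (𝓡 m) x) p).symmL ℝ x).le_of_opNorm_le hx.le
      (tangentCoordChange (𝓡 m) x p x w)
  rw [TangentBundle.symmL_trivializationAt_eq_core (by rwa [extChartAt_source] at hxs)] at h1
  have h2 : tangentCoordChange (𝓡 m) p x x (tangentCoordChange (𝓡 m) x p x w) = w :=
    tangentCoordChange_tangentCoordChange hxs w
  change @norm (TangentSpace (𝓡 m) x) _ (tangentCoordChange (𝓡 m) p x x
    (tangentCoordChange (𝓡 m) x p x w)) ≤ _ at h1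
  rwa [h2] at h1

/-- The chart at `p` is Lipschitz near `p` for the Riemannian distance. -/
theorem exists_nhds_edist_extChartAt_le [IsRiemannianManifold (𝓡 m) M] (p : M) :
    ∃ C : ℝ≥0, 0 < C ∧ ∃ O ∈ 𝓝 p, ∀ x ∈ O, ∀ y ∈ O,
      edist (extChartAt (𝓡 m) p x) (extChartAt (𝓡 m) p y) ≤ C * edist x y := by
  obtain ⟨C, C_pos, hC⟩ := eventually_enorm_mfderiv_extChartAt_lt (𝓡 m) p
  obtain ⟨r, hr, hrs⟩ := EMetric.mem_nhds_iff.1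
    (Filter.inter_mem hC (chart_source_mem_nhds (EuclideanSpace ℝ (Fin m)) p))
  -- A path of length below 2r/3 starting in the ball of radius r/3 stays in the ball of radius r,
  -- where the derivative of the chart is bounded by C.
  refine ⟨C, C_pos, eball p (r / 3), eball_mem_nhds _ (ENNReal.div_pos hr.ne' (by simp)), ?_⟩
  intro x hx y hy
  rw [mem_eball] at hx hy
  by_contra! hlt
  have hxy : edist x y < r / 3 + r / 3 :=
    (edist_triangle_right x y p).trans_lt (ENNReal.add_lt_add hx hy)
  -- If the Lipschitz bound failed, some path would also be shorter than the chart distance divided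
  -- by C; the length of its chart image contradicts this.
  have hlt' : edist x y <
      min (r / 3 + r / 3) (edist (extChartAt (𝓡 m) p x) (extChartAt (𝓡 m) p y) / C) := by
    refine lt_min hxy ?_
    rw [ENNReal.lt_div_iff_mul_lt (by simp [C_pos.ne']) (by simp), mul_comm]
    exact hlt
  rw [IsRiemannianManifold.out (I := 𝓡 m) x y] at hlt'
  obtain ⟨γ, hγx, hγy, γ_smooth, hγ, -⟩ :=
    exists_lt_locally_constant_of_riemannianEDist_lt hlt' zero_lt_one
  obtain ⟨hγ1, hγ2⟩ := lt_min_iff.1 hγ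
  have hmem : ∀ t ∈ Icc (0 : ℝ) 1, γ t ∈ eball p r := by
    intro t ht
    have h1 : edist x (γ t) < r / 3 + r / 3 := by
      rw [IsRiemannianManifold.out (I := 𝓡 m) x (γ t)]
      refine ((riemannianEDist_le_pathELength γ_smooth.contMDiffOn hγx rfl ht.1).trans
        (pathELength_mono le_rfl ht.2)).trans_lt hγ1
    rw [mem_eball]
    calc edist (γ t) p ≤ edist (γ t) x + edist x p := edist_triangle _ _ _
      _ < (r / 3 + r / 3) + r / 3 := by
          rw [edist_comm (γ t) x]; exact ENNReal.add_lt_add h1 hx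
      _ = r := ENNReal.add_thirds r
  let γ' := extChartAt (𝓡 m) p ∘ γ
  have hcd : ContMDiffOn 𝓘(ℝ, ℝ) 𝓘(ℝ, EuclideanSpace ℝ (Fin m)) 1 γ' (Icc 0 1) :=
    contMDiffOn_extChartAt.comp (I' := 𝓡 m) (t := (chartAt (EuclideanSpace ℝ (Fin m)) p).source)
      γ_smooth.contMDiffOn (fun t ht ↦ (hrs (hmem t ht)).2)
  refine lt_irrefl (edist (extChartAt (𝓡 m) p x) (extChartAt (𝓡 m) p y)) ?_
  calc
    edist (extChartAt (𝓡 m) p x) (extChartAt (𝓡 m) p y)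
    _ = ‖γ' 1 - γ' 0‖ₑ := by
      simp only [γ', Function.comp_apply, hγx, hγy]
      rw [edist_comm, edist_eq_enorm_sub]
    _ ≤ ∫⁻ t in Icc 0 1, ‖derivWithin γ' (Icc 0 1) t‖ₑ := by
      apply enorm_sub_le_lintegral_derivWithin_Icc_of_contDiffOn_Icc _ zero_le_one
      rwa [← contMDiffOn_iff_contDiffOn]
    _ ≤ ∫⁻ t in Icc (0 : ℝ) 1, C * ‖mfderivWithin 𝓘(ℝ, ℝ) (𝓡 m) γ (Icc (0 : ℝ) 1) t 1‖ₑ := by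
      apply setLIntegral_mono' measurableSet_Icc (fun t ht ↦ ?_)
      have h1 : mfderivWithin 𝓘(ℝ, ℝ) (𝓡 m) γ' (Icc (0 : ℝ) 1) t =
          (mfderiv (𝓡 m) (𝓡 m) (extChartAt (𝓡 m) p) (γ t)) ∘L (mfderivWithin 𝓘(ℝ, ℝ) (𝓡 m) γ (Icc (0 : ℝ) 1) t) := by
        apply mfderiv_comp_mfderivWithin
        · exact mdifferentiableAt_extChartAt (hrs (hmem t ht)).2
        · exact (γ_smooth.mdifferentiable one_ne_zero).mdifferentiableOn _ ht
        · rw [uniqueMDiffWithinAt_iff_uniqueDiffWithinAt]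
          exact uniqueDiffOn_Icc zero_lt_one _ ht
      have h2 : mfderivWithin 𝓘(ℝ, ℝ) (𝓡 m) γ' (Icc (0 : ℝ) 1) t 1 =
          (mfderiv (𝓡 m) (𝓡 m) (extChartAt (𝓡 m) p) (γ t)) (mfderivWithin 𝓘(ℝ, ℝ) (𝓡 m) γ (Icc (0 : ℝ) 1) t 1) := congr($h1 1)
      have h3 : derivWithin γ' (Icc 0 1) t = mfderivWithin 𝓘(ℝ, ℝ) (𝓡 m) γ' (Icc (0 : ℝ) 1) t 1 := by
        rw [← fderivWithin_derivWithin, mfderivWithin_eq_fderivWithin]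
        rfl
      rw [h3]
      refine (congrArg _ h2).trans_le ?_
      apply (ContinuousLinearMap.le_opENorm _ _).trans
      gcongr
      exact (hrs (hmem t ht)).1.le
    _ = C * pathELength (𝓡 m) γ 0 1 := by
      rw [lintegral_const_mul' _ _ ENNReal.coe_ne_top,
          pathELength_eq_lintegral_mfderivWithin_Icc]
    _ < edist (extChartAt (𝓡 m) p x) (extChartAt (𝓡 m) p y) := by
      rwa [ENNReal.lt_div_iff_mul_lt (by simp [C_pos.ne']) (by simp), mul_comm] at hγ2

end Riemannian

/-! ### Quantitative complements and control near a point -/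

section LocalControl

open Metric Set

/-- If `A` is, approximately and with a bound `K`, surjective modulo `T`, then there is a subspace
`W` of the source of dimension `n = codim T` which `A` maps to a quantitative complement of `T`. -/
theorem exists_complement_of_approx_surjective {E V : Type*} [NormedAddCommGroup E]
    [InnerProductSpace ℝ E] [FiniteDimensional ℝ E] [NormedAddCommGroup V] [NormedSpace ℝ V]
    {d n : ℕ} (hE : d + n = Module.finrank ℝ E) (A : V →L[ℝ] E) {T : Submodule ℝ E}
    (hT : Module.finrank ℝ T = d) {K θ : ℝ} (hK : 0 ≤ K) (hθ : 2 * (n * θ) ≤ 1)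
    (hA : ∀ w : E, ∃ t : V, ‖t‖ ≤ K * ‖w‖ ∧ ∃ u ∈ T, ‖w - A t - u‖ ≤ θ * ‖w‖) :
    ∃ W : Submodule ℝ V, Module.finrank ℝ W = n ∧
      ∀ u ∈ T, ∀ s ∈ W, ‖u‖ + ‖s‖ ≤ (1 + (1 + ‖A‖) * (2 * (n * K))) * ‖u + A s‖ := by
  have hTn : Module.finrank ℝ Tᗮ = n := by
    have := T.finrank_add_finrank_orthogonal
    omega
  let b : OrthonormalBasis (Fin n) ℝ Tᗮ := (stdOrthonormalBasis ℝ Tᗮ).reindex (finCongr hTn)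
  -- W will be the span of approximate preimages `t i` of an orthonormal basis of the orthogonal
  -- complement of T.
  choose t ht u hu hle using fun i ↦ hA (b i : E)
  have hb1 : ∀ i, ‖(b i : E)‖ = 1 := fun i ↦ b.orthonormal.1 i
  simp only [hb1, mul_one] at ht hle
  let R : Tᗮ →ₗ[ℝ] V := b.toBasis.constr ℝ t
  have hR : ∀ w, R w = ∑ i, b.repr w i • t i := fun w ↦ by
    simp [R, Module.Basis.constr_apply_fintype]
  have hrepr : ∀ w i, |b.repr w i| ≤ ‖w‖ := fun w i ↦ by
    rw [← Real.norm_eq_abs, ← b.repr.norm_map w]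
    exact PiLp.norm_apply_le _ i
  have hRK : ∀ w, ‖R w‖ ≤ n * K * ‖w‖ := fun w ↦ by
    rw [hR]
    calc ‖∑ i, b.repr w i • t i‖ ≤ ∑ i : Fin n, ‖w‖ * K := by
          refine (norm_sum_le _ _).trans (Finset.sum_le_sum fun i _ ↦ ?_)
          rw [norm_smul, Real.norm_eq_abs]
          exact mul_le_mul (hrepr w i) (ht i) (norm_nonneg _) (norm_nonneg _)
      _ = n * K * ‖w‖ := by simp; ring
  have hRA : ∀ w : Tᗮ, ∃ u' ∈ T, ‖(w : E) - A (R w) - u'‖ ≤ n * θ * ‖w‖ := fun w ↦ by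
    refine ⟨∑ i, b.repr w i • u i, T.sum_mem fun i _ ↦ T.smul_mem _ (hu i), ?_⟩
    have hw : (w : E) = ∑ i, b.repr w i • (b i : E) := by
      conv_lhs => rw [← b.sum_repr w]
      simp
    have : (w : E) - A (R w) - ∑ i, b.repr w i • u i
        = ∑ i, b.repr w i • ((b i : E) - A (t i) - u i) := by
      rw [hR, map_sum]
      conv_lhs => rw [hw]
      simp only [map_smul, smul_sub, Finset.sum_sub_distrib]
    rw [this]
    calc ‖∑ i, b.repr w i • ((b i : E) - A (t i) - u i)‖ ≤ ∑ i : Fin n, ‖w‖ * θ := by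
          refine (norm_sum_le _ _).trans (Finset.sum_le_sum fun i _ ↦ ?_)
          rw [norm_smul, Real.norm_eq_abs]
          exact mul_le_mul (hrepr w i) (hle i) (norm_nonneg _) (norm_nonneg _)
      _ = n * θ * ‖w‖ := by simp; ring
  have key : ∀ u' ∈ T, ∀ w : Tᗮ, ‖w‖ ≤ 2 * ‖u' + A (R w)‖ := by
    intro u' hu' w
    obtain ⟨u₁, hu₁, h₁⟩ := hRA w
    have hzero : ∀ v ∈ T, Tᗮ.starProjection v = 0 := fun v hv ↦
      (Submodule.starProjection_apply_eq_zero_iff _).2 (by simpa using hv)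
    have hself : Tᗮ.starProjection (w : E) = w :=
      Submodule.starProjection_eq_self_iff.2 w.2
    -- The projection removes `u'` and `u₁`; the remaining error is at most n * θ * ‖w‖ ≤ ‖w‖ / 2
    -- and is absorbed on the left.
    have e : (w : E) = Tᗮ.starProjection (u' + A (R w))
        + Tᗮ.starProjection ((w : E) - A (R w) - u₁) := by
      rw [map_add, map_sub, map_sub, hzero _ hu', hzero _ hu₁, hself]; abel
    have h2 : ‖w‖ ≤ ‖u' + A (R w)‖ + n * θ * ‖w‖ := by
      calc ‖w‖ = ‖(w : E)‖ := rfl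
        _ ≤ _ := by
          conv_lhs => rw [e]
          exact (norm_add_le _ _).trans (add_le_add (Submodule.norm_starProjection_apply_le _ _)
            ((Submodule.norm_starProjection_apply_le _ _).trans h₁))
    have := norm_nonneg w
    nlinarith
  refine ⟨LinearMap.range R, ?_, ?_⟩
  · rw [LinearMap.finrank_range_of_inj, hTn]
    rw [injective_iff_map_eq_zero]
    intro w hw
    have := key 0 T.zero_mem w
    rw [hw] at this
    simpa using this
  · rintro u' hu' _ ⟨w, rfl⟩
    have h1 := key u' hu' w
    have h2 := hRK w
    have h3 : ‖u'‖ ≤ ‖u' + A (R w)‖ + ‖A‖ * ‖R w‖ := by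
      calc ‖u'‖ = ‖(u' + A (R w)) - A (R w)‖ := by rw [add_sub_cancel_right]
        _ ≤ _ := (norm_sub_le _ _).trans (add_le_add le_rfl (A.le_opNorm _))
    have h4 : ‖R w‖ ≤ n * K * (2 * ‖u' + A (R w)‖) := h2.trans (by gcongr)
    calc ‖u'‖ + ‖R w‖ ≤ ‖u' + A (R w)‖ + (1 + ‖A‖) * ‖R w‖ := by linarith
      _ ≤ ‖u' + A (R w)‖ + (1 + ‖A‖) * (n * K * (2 * ‖u' + A (R w)‖)) := by gcongr
      _ = _ := by ring

/-- Velocities of curves in a set whose secants have slope at most `η` over `T` have slope at most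
`η` over `T`. -/
theorem exists_mem_norm_sub_le_of_hasDerivAt {E : Type*} [NormedAddCommGroup E]
    [InnerProductSpace ℝ E] [FiniteDimensional ℝ E] {A : Set E} {T : Submodule ℝ E} {η : ℝ}
    {c : ℝ → E} {u : E} (hA : ∀ x ∈ A, ∀ y ∈ A, ∃ v ∈ T, ‖y - x - v‖ ≤ η * ‖y - x‖)
    (h0 : c 0 ∈ A) (hc : ∀ᶠ s in 𝓝 0, c s ∈ A) (hd : HasDerivAt c u 0) :
    ∃ v ∈ T, ‖u - v‖ ≤ η * ‖u‖ := by
  have hslope := hd.tendsto_slope_zero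
  simp only [zero_add] at hslope
  -- The approximating vector in T varies with s. Its existence is replaced by an inequality for the
  -- normal projection, which passes to the limit.
  have h1 : Filter.Tendsto (fun s : ℝ ↦ ‖Tᗮ.starProjection (s⁻¹ • (c s - c 0))‖) (𝓝[≠] 0)
      (𝓝 ‖Tᗮ.starProjection u‖) :=
    (Tᗮ.starProjection.continuous.tendsto _ |>.comp hslope).norm
  have h2 : Filter.Tendsto (fun s : ℝ ↦ η * ‖s⁻¹ • (c s - c 0)‖) (𝓝[≠] 0) (𝓝 (η * ‖u‖)) :=
    hslope.norm.const_mul η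
  have h3 : ‖Tᗮ.starProjection u‖ ≤ η * ‖u‖ := by
    refine le_of_tendsto_of_tendsto h1 h2 ?_
    filter_upwards [mem_nhdsWithin_of_mem_nhds hc] with s hs
    obtain ⟨v, hv, hle⟩ := hA _ h0 _ hs
    have hv0 : Tᗮ.starProjection v = 0 :=
      (Submodule.starProjection_apply_eq_zero_iff _).2 (by simpa using hv)
    rw [map_smul, norm_smul, norm_smul, mul_left_comm]
    gcongr
    calc ‖Tᗮ.starProjection (c s - c 0)‖ = ‖Tᗮ.starProjection (c s - c 0 - v)‖ := by
          rw [map_sub _ (c s - c 0) v, hv0, sub_zero]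
      _ ≤ _ := (Submodule.norm_starProjection_apply_le _ _).trans hle
  refine ⟨T.starProjection u, T.starProjection_apply_mem u, ?_⟩
  rwa [Submodule.starProjection_orthogonal_val] at h3

variable {m : ℕ} {M : Type*} [TopologicalSpace M] [ChartedSpace (EuclideanSpace ℝ (Fin m)) M]
  [IsManifold (𝓡 m) ∞ M] {V : Type*} [NormedAddCommGroup V] [InnerProductSpace ℝ V]
  [FiniteDimensional ℝ V]
  (X : V →ₗ[ℝ] Cₛ^∞⟮𝓡 m; EuclideanSpace ℝ (Fin m), (TangentSpace (𝓡 m) : M → Type _)⟯)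

theorem HasTangentSpace.sub_mem_tangentSpaceOfSet_iff {S : Set M} {x p : M}
    (hx : x ∈ (extChartAt (𝓡 m) p).source) (hxS : x ∈ S)
    {T : Submodule ℝ (EuclideanSpace ℝ (Fin m))}
    (hT : HasTangentSpace (chartImage (m := m) p S) (extChartAt (𝓡 m) p x) T)
    (w : TangentSpace (𝓡 m) x) (t : V) :
    w - X t x ∈ tangentSpaceOfSet (m := m) S x ↔
      tangentCoordChange (𝓡 m) x p x w - chartField X p (extChartAt (𝓡 m) p x) t ∈ T := by
  rw [hT.mem_tangentSpaceOfSet_iff hx hxS, chartField_extChartAt X hx]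
  exact iff_of_eq (congrArg (· ∈ T) (map_sub (tangentCoordChange (𝓡 m) x p x) w (X t x)))

/-- Near `p`, the members of `F` have small slope over subspaces `T` of the chart at `p`, which are
complemented, with a uniform bound, by the values at `p` of the vector fields in an
`n`-dimensional subspace `W` of `V`. -/
def ControlledAt (n : ℕ) (F : Set (Set M)) (p : M) : Prop :=
  ∃ C > 0, ∀ η > 0, ∃ O ∈ 𝓝 p, O ⊆ (extChartAt (𝓡 m) p).source ∧ ∀ N ∈ F, (N ∩ O).Nonempty →
    ∃ (T : Submodule ℝ (EuclideanSpace ℝ (Fin m))) (W : Submodule ℝ V),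
      Module.finrank ℝ W = n ∧
      (∀ x ∈ N ∩ O, ∀ y ∈ N ∩ O, ∃ u ∈ T,
        ‖extChartAt (𝓡 m) p y - extChartAt (𝓡 m) p x - u‖
          ≤ η * ‖extChartAt (𝓡 m) p y - extChartAt (𝓡 m) p x‖) ∧
      ∀ u ∈ T, ∀ s ∈ W, ‖u‖ + ‖s‖ ≤ C * ‖u + chartField X p (extChartAt (𝓡 m) p p) s‖

/-- For p in N, surjectivity at p alone suffices: the open mapping theorem supplies the bound K,
with no approximation error. Any other p has a neighbourhood missing the closed set N. -/
theorem controlledAt_singleton {d n : ℕ} (hdn : d + n = m) [T2Space M] {N : Set M}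
    (hNc : IsCompact N) (hN : IsEmbeddedSubmanifold (m := m) d N) (hX : SurjectsOntoNormal X N)
    (p : M) : ControlledAt X n {N} p := by
  by_cases hp : p ∈ N
  · have hps := mem_extChartAt_source (I := 𝓡 m) p
    obtain ⟨T, hTd, hT⟩ := hN.exists_hasTangentSpace hp hps
    set A := chartField X p (extChartAt (𝓡 m) p p) with hA
    have hsurj : Function.Surjective (A.coprod T.subtypeL) := by
      intro w
      have h1 : ∀ w : TangentSpace (𝓡 m) p, ∃ t, tangentCoordChange (𝓡 m) p p p w - A t ∈ T :=
        fun w ↦ (hX p hp w).imp fun t ht ↦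
          (hT.sub_mem_tangentSpaceOfSet_iff X hps hp w t).1 ht
      obtain ⟨t, ht⟩ := h1 w
      rw [tangentCoordChange_self hps] at ht
      exact ⟨(t, ⟨_, ht⟩), by simp⟩
    obtain ⟨K, hK, hpre⟩ := ContinuousLinearMap.exists_preimage_norm_le _ hsurj
    obtain ⟨W, hWn, hW⟩ := exists_complement_of_approx_surjective (n := n) (by simpa using hdn) A
      hTd hK.le (θ := 0) (by simp) (fun w ↦ by
        obtain ⟨⟨t, u⟩, rfl, hle⟩ := hpre w
        exact ⟨t, (norm_fst_le ((t, u) : V × T)).trans hle, u, u.2, by simp⟩)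
    refine ⟨1 + (1 + ‖A‖) * (2 * (n * K)), by positivity, fun η hη ↦ ?_⟩
    obtain ⟨O₁, hO₁, h₁⟩ := hT.exists_nhds η hη
    refine ⟨(extChartAt (𝓡 m) p).source ∩ extChartAt (𝓡 m) p ⁻¹' O₁,
      Filter.inter_mem (extChartAt_source_mem_nhds p)
        ((continuousAt_extChartAt p).preimage_mem_nhds hO₁), inter_subset_left, ?_⟩
    rintro _ rfl -
    refine ⟨T, W, hWn, fun x hx y hy ↦ ?_, hW⟩
    exact h₁ _ ⟨extChartAt_mem_chartImage hx.2.1 hx.1, hx.2.2⟩ _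
      ⟨extChartAt_mem_chartImage hy.2.1 hy.1, hy.2.2⟩
  · refine ⟨1, one_pos, fun η _ ↦ ⟨(extChartAt (𝓡 m) p).source ∩ Nᶜ,
      Filter.inter_mem (extChartAt_source_mem_nhds p) (hNc.isClosed.isOpen_compl.mem_nhds hp),
      inter_subset_left, ?_⟩⟩
    rintro _ rfl ⟨x, hxN, -, hxN'⟩
    exact absurd hxN hxN'

end LocalControl

/-! ### Control for uniform families -/

section UniformControl

open Metric Set

variable {m : ℕ} {M : Type*} [EMetricSpace M] [ChartedSpace (EuclideanSpace ℝ (Fin m)) M]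
  [IsManifold (𝓡 m) ∞ M] [RiemannianBundle (fun x : M => TangentSpace (𝓡 m) x)]
  [IsContinuousRiemannianBundle (EuclideanSpace ℝ (Fin m)) (fun x : M => TangentSpace (𝓡 m) x)]
  {V : Type*} [NormedAddCommGroup V] [InnerProductSpace ℝ V] [FiniteDimensional ℝ V]
  (X : V →ₗ[ℝ] Cₛ^∞⟮𝓡 m; EuclideanSpace ℝ (Fin m), (TangentSpace (𝓡 m) : M → Type _)⟯)

/-- A member of F need not contain p, so surjectivity is available only at a nearby point x₀, modulo
the tangent space there. Continuity of the fields moves it to p, and the slope bound replaces the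
tangent space by T; approximate surjectivity survives both changes. -/
theorem controlledAt_of_uniform {d n : ℕ} (hdn : d + n = m) {F : Set (Set M)}
    (hF : ∀ N ∈ F, IsEmbeddedSubmanifold (m := m) d N) (hC1 : UniformlyC1 (m := m) d F)
    (hX : UniformlySurjectsOntoNormal X F) (p : M) : ControlledAt X n F p := by
  obtain ⟨K, hK⟩ := hX
  obtain ⟨C₁, hC₁, hnorm⟩ := eventually_norm_le_norm_tangentCoordChange (m := m) p
  set A := chartField X p (extChartAt (𝓡 m) p p) with hA
  -- The factor C₁ converts the Riemannian norm in the surjectivity bound into the chart norm.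
  set K' := |K| * C₁ with hK'
  have hK'0 : 0 ≤ K' := by positivity
  refine ⟨1 + (1 + ‖A‖) * (2 * (n * K')), by positivity, fun η hη ↦ ?_⟩
  -- This ensures 2 * n * θ ≤ 1, also for n = 0. Below, δ and η₁ are chosen so that moving the
  -- fields and tilting the tangent space each cost at most θ / 2.
  set θ : ℝ := 1 / (2 * (n + 1)) with hθ
  have hθ0 : 0 < θ := by positivity
  set δ : ℝ := min 1 (θ / (2 * (K' + 1))) with hδ
  have hδ0 : 0 < δ := by positivity
  set η₁ : ℝ := min η (θ / (2 * (1 + (‖A‖ + 1) * K'))) with hη₁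
  have hη₁0 : 0 < η₁ := by positivity
  obtain ⟨O₁, hO₁, hO₁s, h₁⟩ := hC1 p η₁ hη₁0
  have hcont : ∀ᶠ x in 𝓝 p, ‖chartField X p (extChartAt (𝓡 m) p x) - A‖ < δ := by
    have h1 : ContinuousAt (fun x ↦ chartField X p (extChartAt (𝓡 m) p x)) p :=
      ContinuousAt.comp (g := chartField X p) (contDiffAt_chartField X p).continuousAt
        (continuousAt_extChartAt p)
    have := h1.eventually (ball_mem_nhds _ hδ0)
    simpa only [mem_ball, dist_eq_norm] using this
  obtain ⟨O, hOsub, hOo, hpO⟩ := mem_nhds_iff.1 (Filter.inter_mem hO₁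
    (Filter.inter_mem hnorm hcont))
  have hOs : O ⊆ (extChartAt (𝓡 m) p).source := fun x hx ↦ by
    rw [extChartAt_source]; exact hO₁s (hOsub hx).1
  refine ⟨O, hOo.mem_nhds hpO, hOs, ?_⟩
  rintro N hN ⟨x₀, hx₀N, hx₀O⟩
  obtain ⟨T, hTd, hT⟩ := h₁ N hN
  have hx₀s := hOs hx₀O
  obtain ⟨T₀, -, hT₀⟩ := (hF N hN).exists_hasTangentSpace hx₀N hx₀s
  have hgraph : ∀ x ∈ N ∩ O, ∀ y ∈ N ∩ O, ∃ u ∈ T,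
        ‖extChartAt (𝓡 m) p y - extChartAt (𝓡 m) p x - u‖
          ≤ η₁ * ‖extChartAt (𝓡 m) p y - extChartAt (𝓡 m) p x‖ := fun x hx y hy ↦
    hT x ⟨hx.1, (hOsub hx.2).1⟩ y ⟨hy.1, (hOsub hy.2).1⟩
  -- the tangent space at `x₀` is close to `T`
  have hT₀T : ∀ u ∈ T₀, ∃ v ∈ T, ‖u - v‖ ≤ η₁ * ‖u‖ := by
    intro u hu
    obtain ⟨c, hc0, hc, hd⟩ := hT₀.exists_curve u hu
    refine exists_mem_norm_sub_le_of_hasDerivAt (A := extChartAt (𝓡 m) p '' (N ∩ O)) ?_ ?_ ?_ hd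
    · rintro _ ⟨x, hx, rfl⟩ _ ⟨y, hy, rfl⟩
      exact hgraph x hx y hy
    · exact ⟨x₀, ⟨hx₀N, hx₀O⟩, hc0.symm⟩
    · have hnear : ∀ᶠ s in 𝓝 (0 : ℝ), (extChartAt (𝓡 m) p).symm (c s) ∈ O := by
        have h2 : ContinuousAt ((extChartAt (𝓡 m) p).symm ∘ c) 0 := by
          refine ContinuousAt.comp ?_ hd.continuousAt
          rw [hc0]
          exact continuousAt_extChartAt_symm' hx₀s
        refine h2.preimage_mem_nhds (hOo.mem_nhds ?_)
        rwa [Function.comp_apply, hc0, (extChartAt (𝓡 m) p).left_inv hx₀s]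
      filter_upwards [hc, hnear] with s hs hs'
      exact ⟨_, ⟨hs.2, hs'⟩, (extChartAt (𝓡 m) p).right_inv hs.1⟩
  have happrox : ∀ w : EuclideanSpace ℝ (Fin m), ∃ t : V, ‖t‖ ≤ K' * ‖w‖ ∧
      ∃ u ∈ T, ‖w - A t - u‖ ≤ θ * ‖w‖ := by
    intro w
    have h1 : ∀ w : TangentSpace (𝓡 m) x₀, ∃ t, ‖t‖ ≤ K' * ‖tangentCoordChange (𝓡 m) x₀ p x₀ w‖ ∧
        tangentCoordChange (𝓡 m) x₀ p x₀ w - chartField X p (extChartAt (𝓡 m) p x₀) t ∈ T₀ := by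
      intro w
      obtain ⟨t, ht, htT⟩ := hK N hN x₀ hx₀N w
      refine ⟨t, ?_, (hT₀.sub_mem_tangentSpaceOfSet_iff X hx₀s hx₀N w t).1 htT⟩
      calc ‖t‖ ≤ K * ‖w‖ := ht
        _ ≤ |K| * (C₁ * ‖tangentCoordChange (𝓡 m) x₀ p x₀ w‖) :=
          (mul_le_mul_of_nonneg_right (le_abs_self K) (norm_nonneg _)).trans
            (mul_le_mul_of_nonneg_left ((hOsub hx₀O).2.1 w) (abs_nonneg K))
        _ = K' * ‖tangentCoordChange (𝓡 m) x₀ p x₀ w‖ := by rw [hK']; ring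
    obtain ⟨t, htK, htT⟩ := h1 (tangentCoordChange (𝓡 m) p x₀ x₀ w)
    rw [tangentCoordChange_tangentCoordChange' hx₀s] at htK htT
    refine ⟨t, htK, ?_⟩
    obtain ⟨v, hv, hle⟩ := hT₀T _ htT
    refine ⟨v, hv, ?_⟩
    set A₀ := chartField X p (extChartAt (𝓡 m) p x₀)
    have hA₀ : ‖A₀ - A‖ ≤ δ := (hOsub hx₀O).2.2.le
    have h4 : ‖(A₀ - A) t‖ ≤ δ * (K' * ‖w‖) :=
      (ContinuousLinearMap.le_opNorm _ _).trans (mul_le_mul hA₀ htK (norm_nonneg _) hδ0.le)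
    have h5 : ‖A t‖ ≤ ‖A‖ * (K' * ‖w‖) :=
      (ContinuousLinearMap.le_opNorm _ _).trans (by gcongr)
    have h6 : ‖w - A₀ t‖ ≤ (1 + (‖A‖ + 1) * K') * ‖w‖ := by
      have e : w - A₀ t = w - A t - (A₀ - A) t := by rw [sub_apply]; abel
      have hδ1 : δ ≤ 1 := min_le_left _ _
      calc ‖w - A₀ t‖ ≤ ‖w‖ + ‖A‖ * (K' * ‖w‖) + δ * (K' * ‖w‖) := by
            rw [e]
            exact (norm_sub_le _ _).trans (add_le_add ((norm_sub_le _ _).trans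
              (add_le_add le_rfl h5)) h4)
        _ ≤ ‖w‖ + ‖A‖ * (K' * ‖w‖) + 1 * (K' * ‖w‖) := by gcongr
        _ = _ := by ring
    have e : w - A t - v = (w - A₀ t - v) + (A₀ - A) t := by rw [sub_apply]; abel
    have h7 : η₁ * (1 + (‖A‖ + 1) * K') ≤ θ / 2 := by
      calc η₁ * (1 + (‖A‖ + 1) * K')
          ≤ θ / (2 * (1 + (‖A‖ + 1) * K')) * (1 + (‖A‖ + 1) * K') := by
            gcongr; exact min_le_right _ _
        _ = θ / 2 := by field_simp
    have h8 : δ * K' ≤ θ / 2 := by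
      calc δ * K' ≤ θ / (2 * (K' + 1)) * (K' + 1) := by
            gcongr
            · exact min_le_right _ _
            · linarith
        _ = θ / 2 := by field_simp
    calc ‖w - A t - v‖ ≤ η₁ * ((1 + (‖A‖ + 1) * K') * ‖w‖) + δ * (K' * ‖w‖) := by
          rw [e]
          exact (norm_add_le _ _).trans (add_le_add (hle.trans (by gcongr)) h4)
      _ = (η₁ * (1 + (‖A‖ + 1) * K')) * ‖w‖ + (δ * K') * ‖w‖ := by ring
      _ ≤ θ / 2 * ‖w‖ + θ / 2 * ‖w‖ := by gcongr
      _ = θ * ‖w‖ := by ring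
  obtain ⟨W, hWn, hW⟩ := exists_complement_of_approx_surjective (n := n) (by simpa using hdn) A
    hTd hK'0 (θ := θ) (by
      rw [hθ]; field_simp; linarith) happrox
  refine ⟨T, W, hWn, fun x hx y hy ↦ ?_, hW⟩
  obtain ⟨u, hu, hle⟩ := hgraph x hx y hy
  exact ⟨u, hu, hle.trans (by gcongr; exact min_le_left _ _)⟩

end UniformControl

/-! ### The separation estimate -/

section Separation

open Metric Set

variable {m : ℕ} {M : Type*} [TopologicalSpace M] [ChartedSpace (EuclideanSpace ℝ (Fin m)) M]
  [IsManifold (𝓡 m) ∞ M] {V : Type*} [NormedAddCommGroup V] [InnerProductSpace ℝ V]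
  [FiniteDimensional ℝ V]
  {X : V →ₗ[ℝ] Cₛ^∞⟮𝓡 m; EuclideanSpace ℝ (Fin m), (TangentSpace (𝓡 m) : M → Type _)⟯}

/-- Points of different perturbations `timeOneMap (X t) '' N`, with the difference of the
parameters in `W`, are quantitatively separated. -/
theorem ControlledAt.exists_separation [T2Space M] [CompactSpace M] {n : ℕ} {F : Set (Set M)}
    {p : M} (h : ControlledAt X n F p) {O' : Set M} (hO' : O' ∈ 𝓝 p) :
    ∃ O ∈ 𝓝 p, O ⊆ (extChartAt (𝓡 m) p).source ∧ ∃ ε > 0, ∃ C > 0,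
      ∃ Φ : V × EuclideanSpace ℝ (Fin m) → EuclideanSpace ℝ (Fin m),
      (∀ t ∈ ball (0 : V) ε, ∀ x ∈ O,
        timeOneMap (X t) x ∈ (extChartAt (𝓡 m) p).source ∧ timeOneMap (X t) x ∈ O' ∧
        extChartAt (𝓡 m) p (timeOneMap (X t) x) = Φ (t, extChartAt (𝓡 m) p x) ∧
        DifferentiableAt ℝ Φ (t, extChartAt (𝓡 m) p x)) ∧
      ∀ N ∈ F, (N ∩ O).Nonempty → ∃ W : Submodule ℝ V, Module.finrank ℝ W = n ∧
        ∀ t ∈ ball (0 : V) ε, ∀ t' ∈ ball (0 : V) ε, ∀ x ∈ N ∩ O, ∀ x' ∈ N ∩ O,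
          ‖extChartAt (𝓡 m) p x - extChartAt (𝓡 m) p x'‖ + ‖t - t'‖ ≤
            C * (‖Φ (t, extChartAt (𝓡 m) p x) - Φ (t', extChartAt (𝓡 m) p x')‖
              + ‖Wᗮ.starProjection (t - t')‖) := by
  obtain ⟨C₀, hC₀, hctl⟩ := h
  set A := chartField X p (extChartAt (𝓡 m) p p)
  -- In `ControlledAt` the constant precedes η, so η may depend on C₀. With (2 * C₀ + 1) * η = 1 / 2
  -- the errors proportional to `S` are absorbed.
  set η : ℝ := 1 / (2 * (2 * C₀ + 1)) with hη
  have hη0 : 0 < η := by positivity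
  have hηC : (2 * C₀ + 1) * η = 1 / 2 := by rw [hη]; field_simp
  obtain ⟨O₁, hO₁, hO₁s, h₁⟩ := hctl η hη0
  obtain ⟨O₂, hO₂, hO₂s, ε, hε, Φ, hΦ, hΦs⟩ := exists_timeOneMap_chart X p hη0 hO'
  refine ⟨O₁ ∩ O₂, Filter.inter_mem hO₁ hO₂, inter_subset_left.trans hO₁s, ε, hε,
    2 * C₀ + 2 * (C₀ * ‖A‖ + 1), by positivity, Φ, fun t ht x hx ↦ hΦ t ht x hx.2, ?_⟩
  rintro N hN ⟨x₀, hx₀N, hx₀, -⟩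
  obtain ⟨T, W, hWn, hT, hW⟩ := h₁ N hN ⟨x₀, hx₀N, hx₀⟩
  refine ⟨W, hWn, ?_⟩
  rintro t ht t' ht' x ⟨hxN, hx1, hx2⟩ x' ⟨hxN', hx1', hx2'⟩
  have hstrict := hΦs t ht t' ht' x hx2 x' hx2'
  obtain ⟨u, hu, hule⟩ := hT x' ⟨hxN', hx1'⟩ x ⟨hxN, hx1⟩
  set h := extChartAt (𝓡 m) p x - extChartAt (𝓡 m) p x'
  set Δ := Φ (t, extChartAt (𝓡 m) p x) - Φ (t', extChartAt (𝓡 m) p x')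
  set τ := t - t'
  -- Only the W-component of the parameter difference is controlled by the complement property; the
  -- orthogonal component is kept on the right-hand side.
  set s := W.starProjection τ
  set r := Wᗮ.starProjection τ
  have hsr : τ = s + r := (W.starProjection_add_starProjection_orthogonal τ).symm
  have h1 := hW u hu s (W.starProjection_apply_mem τ)
  have h2 : ‖u + A s‖ ≤ ‖Δ‖ + η * (‖h‖ + ‖τ‖) + η * ‖h‖ + ‖A‖ * ‖r‖ := by
    have e : u + A s = Δ - (Δ - h - A τ) - (h - u) - A r := by
      rw [hsr, map_add]; abel
    rw [e]
    exact (norm_sub_le _ _).trans (add_le_add ((norm_sub_le _ _).trans (add_le_add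
      ((norm_sub_le _ _).trans (add_le_add le_rfl hstrict)) hule)) (A.le_opNorm r))
  have h3 : ‖h‖ ≤ ‖u‖ + η * ‖h‖ := by
    calc ‖h‖ = ‖u + (h - u)‖ := by rw [add_sub_cancel]
      _ ≤ _ := (norm_add_le _ _).trans (add_le_add le_rfl hule)
  have h4 : ‖τ‖ ≤ ‖s‖ + ‖r‖ := by
    calc ‖τ‖ = ‖s + r‖ := by rw [← hsr]
      _ ≤ _ := norm_add_le _ _
  set S := ‖h‖ + ‖τ‖ with hS
  have hhS : ‖h‖ ≤ S := le_add_of_nonneg_right (norm_nonneg _)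
  have h5 : S ≤ C₀ * (‖Δ‖ + η * S + η * S + ‖A‖ * ‖r‖) + η * S + ‖r‖ := by
    calc S ≤ (‖u‖ + ‖s‖) + η * ‖h‖ + ‖r‖ := by rw [hS]; linarith
      _ ≤ C₀ * (‖Δ‖ + η * S + η * ‖h‖ + ‖A‖ * ‖r‖) + η * ‖h‖ + ‖r‖ := by
          gcongr
          exact h1.trans (by gcongr)
      _ ≤ _ := by gcongr
  have h6 : C₀ * (‖Δ‖ + η * S + η * S + ‖A‖ * ‖r‖) + η * S + ‖r‖
      = C₀ * ‖Δ‖ + ((2 * C₀ + 1) * η) * S + (C₀ * ‖A‖ + 1) * ‖r‖ := by ring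
  rw [h6, hηC] at h5
  have h7 : S ≤ 2 * C₀ * ‖Δ‖ + 2 * (C₀ * ‖A‖ + 1) * ‖r‖ := by linarith
  have h8 : 0 ≤ 2 * C₀ * ‖r‖ := by positivity
  have h9 : 0 ≤ 2 * (C₀ * ‖A‖ + 1) * ‖Δ‖ := by positivity
  calc S ≤ 2 * C₀ * ‖Δ‖ + 2 * (C₀ * ‖A‖ + 1) * ‖r‖ := h7
    _ ≤ _ := by linarith

end Separation

/-! ### Volume of parameter sets by slicing -/

section Volume

open Metric Set MeasureTheory

/-- A subset of a ball whose slices along translates of `W` have diameter `O(ρ)`, has volume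
`O(ε ^ (k - n) ρ ^ n)`. -/
theorem volume_closure_le_of_slices {V : Type*} [NormedAddCommGroup V] [InnerProductSpace ℝ V]
    [FiniteDimensional ℝ V] [MeasurableSpace V] [BorelSpace V] {n : ℕ} (W : Submodule ℝ V)
    (hW : Module.finrank ℝ W = n) {E : Set V} {ε C ρ : ℝ} (hε : 0 ≤ ε) (hC : 0 ≤ C) (hρ : 0 ≤ ρ)
    (hE : E ⊆ ball 0 ε)
    (h : ∀ t ∈ E, ∀ t' ∈ E, ‖t - t'‖ ≤ C * (ρ + ‖Wᗮ.starProjection (t - t')‖)) :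
    volume (closure E) ≤
      ENNReal.ofReal ((2 * ε) ^ (Module.finrank ℝ V - n) * (2 * (C * ρ)) ^ n) := by
  set l := Module.finrank ℝ V - n with hl
  have hWl : Module.finrank ℝ Wᗮ = l := by
    have := W.finrank_add_finrank_orthogonal
    omega
  -- an orthonormal basis adapted to `W`
  let b₁ : OrthonormalBasis (Fin n) ℝ W := (stdOrthonormalBasis ℝ W).reindex (finCongr hW)
  let b₂ : OrthonormalBasis (Fin l) ℝ Wᗮ := (stdOrthonormalBasis ℝ Wᗮ).reindex (finCongr hWl)
  have hon : Orthonormal ℝ (Sum.elim (fun i ↦ (b₁ i : V)) fun j ↦ (b₂ j : V)) := by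
    rw [orthonormal_iff_ite]
    rintro (i | i) (j | j)
    · simpa using orthonormal_iff_ite.1 b₁.orthonormal i j
    · simpa using Submodule.inner_right_of_mem_orthogonal (b₁ i).2 (b₂ j).2
    · simpa using Submodule.inner_left_of_mem_orthogonal (b₁ j).2 (b₂ i).2
    · simpa using orthonormal_iff_ite.1 b₂.orthonormal i j
  let b : OrthonormalBasis (Fin n ⊕ Fin l) ℝ V := OrthonormalBasis.mk hon (by
    have hli := hon.linearIndependent
    rw [hli.span_eq_top_of_card_eq_finrank' (by simp; have := W.finrank_le; omega)])
  have hb₁ : ∀ i, b (.inl i) ∈ W := fun i ↦ by simp [b]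
  have hb₂ : ∀ j, b (.inr j) ∈ Wᗮ := fun j ↦ by simp [b]
  -- coordinates
  let g : V ≃ᵐ (Fin n → ℝ) × (Fin l → ℝ) :=
    (b.measurableEquiv.trans (MeasurableEquiv.toLp 2 (Fin n ⊕ Fin l → ℝ)).symm).trans
      (MeasurableEquiv.sumPiEquivProdPi fun _ ↦ ℝ)
  have hg : MeasurePreserving g :=
    (volume_measurePreserving_sumPiEquivProdPi fun _ ↦ ℝ).comp
      ((EuclideanSpace.volume_preserving_symm_measurableEquiv_toLp _).comp
        b.measurePreserving_measurableEquiv)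
  have hg₁ : ∀ t i, (g t).1 i = inner ℝ (b (.inl i)) t := fun t i ↦ b.repr_apply_apply t _
  have hg₂ : ∀ t j, (g t).2 j = inner ℝ (b (.inr j)) t := fun t j ↦ b.repr_apply_apply t _
  have hnb : ∀ i, ‖b i‖ = 1 := b.norm_eq_one
  have hEε : ∀ t ∈ closure E, ‖t‖ ≤ ε := fun t ht ↦
    mem_closedBall_zero_iff.1 (closure_minimal (hE.trans ball_subset_closedBall)
      isClosed_closedBall ht)
  -- The estimate is a closed condition. Passing to the closure makes Fubini applicable without
  -- measurability of E.
  have hcl : ∀ t ∈ closure E, ∀ t' ∈ closure E,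
      ‖t - t'‖ ≤ C * (ρ + ‖Wᗮ.starProjection (t - t')‖) := by
    have hclosed : IsClosed {q : V × V | ‖q.1 - q.2‖ ≤
        C * (ρ + ‖Wᗮ.starProjection (q.1 - q.2)‖)} :=
      isClosed_le (by fun_prop) (by fun_prop)
    intro t ht t' ht'
    have : (t, t') ∈ closure (E ×ˢ E) := by rw [closure_prod_eq]; exact ⟨ht, ht'⟩
    exact closure_minimal (s := E ×ˢ E) (fun q hq ↦ h _ hq.1 _ hq.2) hclosed this
  -- Two points of a slice differ by an element of W, so they are within C * ρ; slices with ‖y‖ > ε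
  -- are empty.
  have hslice : ∀ y : Fin l → ℝ, volume ((fun x ↦ (x, y)) ⁻¹' (g.symm ⁻¹' closure E)) ≤
      (closedBall (0 : Fin l → ℝ) ε).indicator
        (fun _ ↦ ENNReal.ofReal ((2 * (C * ρ)) ^ n)) y := by
    intro y
    rcases Set.eq_empty_or_nonempty ((fun x ↦ (x, y)) ⁻¹' (g.symm ⁻¹' closure E)) with h0 | ⟨x, hx⟩
    · rw [h0, measure_empty]; exact zero_le
    have hx' : g.symm (x, y) ∈ closure E := hx
    have hy : y ∈ closedBall (0 : Fin l → ℝ) ε := by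
      rw [mem_closedBall_zero_iff, pi_norm_le_iff_of_nonneg hε]
      intro j
      have : y j = inner ℝ (b (.inr j)) (g.symm (x, y)) := by rw [← hg₂, g.apply_symm_apply]
      rw [this]
      refine (norm_inner_le_norm _ _).trans ?_
      rw [hnb, one_mul]
      exact hEε _ hx'
    have hvol : volume (closedBall x (C * ρ)) = ENNReal.ofReal ((2 * (C * ρ)) ^ n) := by
      rw [Real.volume_pi_closedBall x (by positivity), Fintype.card_fin]
    rw [indicator_of_mem hy, ← hvol]
    refine measure_mono fun x' hx' ↦ ?_
    rw [mem_closedBall, dist_eq_norm, pi_norm_le_iff_of_nonneg (by positivity)]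
    intro i
    have hx'' : g.symm (x', y) ∈ closure E := hx'
    have hz : Wᗮ.starProjection (g.symm (x', y) - g.symm (x, y)) = 0 := by
      refine Submodule.starProjection_orthogonal_apply_eq_zero ?_
      rw [← b.sum_repr' (g.symm (x', y) - g.symm (x, y)), Fintype.sum_sum_type]
      refine add_mem (sum_mem fun i _ ↦ W.smul_mem _ (hb₁ i)) (sum_mem fun j _ ↦ ?_)
      rw [inner_sub_right, ← hg₂, ← hg₂, g.apply_symm_apply, g.apply_symm_apply, sub_self,
        zero_smul]
      exact zero_mem _
    have h1 := hcl _ hx'' _ hx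
    rw [hz, norm_zero, add_zero] at h1
    have e : (x' - x) i = inner ℝ (b (.inl i)) (g.symm (x', y) - g.symm (x, y)) := by
      rw [inner_sub_right, ← hg₁, ← hg₁, g.apply_symm_apply, g.apply_symm_apply, Pi.sub_apply]
    rw [e]
    refine (norm_inner_le_norm _ _).trans ?_
    rw [hnb, one_mul]
    exact h1
  calc volume (closure E) = volume (g.symm ⁻¹' closure E) :=
        ((hg.symm g).measure_preimage_equiv _).symm
    _ = ∫⁻ y, volume ((fun x ↦ (x, y)) ⁻¹' (g.symm ⁻¹' closure E)) :=
        Measure.prod_apply_symm (g.symm.measurable isClosed_closure.measurableSet)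
    _ ≤ ∫⁻ y, (closedBall (0 : Fin l → ℝ) ε).indicator
        (fun _ ↦ ENNReal.ofReal ((2 * (C * ρ)) ^ n)) y := lintegral_mono hslice
    _ = ENNReal.ofReal ((2 * (C * ρ)) ^ n) * ENNReal.ofReal ((2 * ε) ^ l) := by
        rw [lintegral_indicator_const isClosed_closedBall.measurableSet,
          Real.volume_pi_closedBall _ hε, Fintype.card_fin]
    _ = _ := by rw [← ENNReal.ofReal_mul (by positivity), mul_comm]

end Volume

/-! ### An Eilenberg-type inequality -/

section Eilenberg

open Metric Set MeasureTheory Filter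

theorem Set.encard_toENNReal_le_of_forall_finset {α : Type*} {s : Set α} {c : ℝ≥0∞}
    (h : ∀ F : Finset α, (F : Set α) ⊆ s → (F.card : ℝ≥0∞) ≤ c) : (s.encard : ℝ≥0∞) ≤ c := by
  rcases s.finite_or_infinite with hs | hs
  · have := h hs.toFinset (by simp)
    rw [hs.encard_eq_coe_toFinset_card]
    simpa using this
  · have : c = ⊤ := by
      refine ENNReal.eq_top_of_forall_nnreal_le fun r ↦ ?_
      obtain ⟨k, hk⟩ := exists_nat_ge r
      obtain ⟨F, hF, rfl⟩ := hs.exists_subset_card_eq k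
      exact le_trans (by exact_mod_cast hk) (h F hF)
    simp [this]

/-- **Eilenberg's inequality**, for families of sets indexed by a measure space: if the parameters
`t` for which `I t` meets a set `A` have measure at most `Q * diam A ^ n`, then the number of
points of `I t ∩ U` has integral at most `Q` times the `n`-dimensional measure of `U`. -/
theorem exists_lintegral_le_hausdorffMeasure {M : Type*} [EMetricSpace M] [MeasurableSpace M]
    [BorelSpace M] {V : Type*} [MeasurableSpace V] {μ : Measure V} (I : V → Set M) {n : ℕ}
    {Q : ℝ≥0∞} (hQ : Q ≠ ⊤) {B : Set V}
    (h : ∀ A : Set M, A.Nonempty → ediam A ≠ ⊤ → ∃ E, MeasurableSet E ∧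
      (∀ t ∈ B, (I t ∩ A).Nonempty → t ∈ E) ∧ μ E ≤ Q * ediam A ^ n)
    {U : Set M} (hU : μH[n] U ≠ ⊤) :
    ∃ G : V → ℝ≥0∞, Measurable G ∧ (∀ t ∈ B, ((I t ∩ U).encard : ℝ≥0∞) ≤ G t) ∧
      ∫⁻ t, G t ∂μ ≤ Q * μH[n] U := by
  have hcov : ∀ j : ℕ, ∃ s : ℕ → Set M, U ⊆ ⋃ i, s i ∧ (∀ i, ediam (s i) ≤ (j + 1 : ℝ≥0∞)⁻¹) ∧
      ∑' i, ⨆ _ : (s i).Nonempty, ediam (s i) ^ (n : ℝ) < μH[n] U + (j + 1 : ℝ≥0∞)⁻¹ := by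
    intro j
    have hr : (0 : ℝ≥0∞) < (j + 1 : ℝ≥0∞)⁻¹ := by
      rw [ENNReal.inv_pos]; exact_mod_cast ENNReal.natCast_ne_top (j + 1)
    have h1 := ENNReal.lt_add_right hU hr.ne'
    rw [Measure.hausdorffMeasure_apply] at h1
    have h2 := (le_iSup₂ (f := fun (r : ℝ≥0∞) (_ : 0 < r) ↦
      ⨅ (t : ℕ → Set M) (_ : U ⊆ ⋃ i, t i) (_ : ∀ i, ediam (t i) ≤ r),
        ∑' i, ⨆ _ : (t i).Nonempty, ediam (t i) ^ (n : ℝ)) _ hr).trans_lt h1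
    simp only [iInf_lt_iff] at h2
    obtain ⟨s, hs1, hs2, hs3⟩ := h2
    refine ⟨s, hs1, hs2, ?_⟩
    rwa [Measure.hausdorffMeasure_apply]
  choose s hsU hsd hsum using hcov
  have hE : ∀ j i, ∃ E, MeasurableSet E ∧ (∀ t ∈ B, (I t ∩ s j i).Nonempty → t ∈ E) ∧
      μ E ≤ Q * ⨆ _ : (s j i).Nonempty, ediam (s j i) ^ (n : ℝ) := by
    intro j i
    -- An empty piece must contribute 0, whereas `ediam ∅ ^ n` would be 1 for n = 0.
    by_cases hne : (s j i).Nonempty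
    · simp only [hne, iSup_pos, ENNReal.rpow_natCast]
      refine h _ hne (ne_top_of_le_ne_top ?_ (hsd j i))
      simp
    · exact ⟨∅, MeasurableSet.empty, fun t _ ht ↦ (hne (ht.mono inter_subset_right)).elim, by simp⟩
  choose E hEm hEI hEμ using hE
  -- `G j` is a measurable upper bound for the number of pieces of the j-th cover met by `I t`; the
  -- number of points itself need not be measurable in t.
  let G : ℕ → V → ℝ≥0∞ := fun j t ↦ ∑' i, (E j i).indicator 1 t
  have hGm : ∀ j, Measurable (G j) := fun j ↦
    Measurable.tsum fun i ↦ measurable_one.indicator (hEm j i)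
  refine ⟨fun t ↦ liminf (fun j ↦ G j t) atTop, Measurable.liminf hGm, fun t ht ↦ ?_, ?_⟩
  · refine Set.encard_toENNReal_le_of_forall_finset fun F hF ↦ ?_
    refine le_liminf_of_le (by isBoundedDefault) ?_
    -- Once the mesh is below the least distance between points of `F`, distinct points lie in
    -- distinct pieces, so `G j t` is at least the cardinality of `F`.
    obtain ⟨δ, hδ, hsep⟩ : ∃ δ > (0 : ℝ≥0∞), ∀ x ∈ F, ∀ y ∈ F, x ≠ y → δ ≤ edist x y := by
      exact ⟨_, Set.einfsep_pos_of_finite (s := (F : Set M)), Set.le_einfsep_iff.1 le_rfl⟩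
    have htend : Tendsto (fun j : ℕ ↦ (j + 1 : ℝ≥0∞)⁻¹) atTop (𝓝 0) := by
      have := (tendsto_add_atTop_iff_nat 1).2 ENNReal.tendsto_inv_nat_nhds_zero
      simpa using this
    filter_upwards [htend.eventually_lt_const hδ] with j hj
    have hmem : ∀ x : F, ∃ i, (x : M) ∈ s j i := fun x ↦ mem_iUnion.1 (hsU j (hF x.2).2)
    choose i hi using hmem
    have hinj : Function.Injective i := by
      intro x y hxy
      by_contra hne
      have h1 := hsep x x.2 y y.2 fun e ↦ hne (Subtype.ext e)
      exact absurd (h1.trans ((edist_le_ediam_of_mem (hi x) (hxy ▸ hi y)).trans (hsd j _)))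
        (not_le.2 hj)
    calc (F.card : ℝ≥0∞) = ∑ x : F, (E j (i x)).indicator 1 t := by
          have h1 : ∀ x : F, (E j (i x)).indicator (1 : V → ℝ≥0∞) t = 1 := fun x ↦
            indicator_of_mem (hEI j _ t ht ⟨x, (hF x.2).1, hi x⟩) _
          simp [h1]
      _ = ∑' x : F, (E j (i x)).indicator 1 t := (tsum_fintype _).symm
      _ ≤ G j t := ENNReal.tsum_comp_le_tsum_of_injective hinj fun i ↦ (E j i).indicator 1 t
  · have hint : ∀ j, ∫⁻ t, G j t ∂μ ≤ Q * (μH[n] U + (j + 1 : ℝ≥0∞)⁻¹) := by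
      intro j
      calc ∫⁻ t, G j t ∂μ = ∑' i, μ (E j i) := by
            rw [lintegral_tsum fun i ↦ (measurable_one.indicator (hEm j i)).aemeasurable]
            exact tsum_congr fun i ↦ lintegral_indicator_one (hEm j i)
        _ ≤ ∑' i, Q * ⨆ _ : (s j i).Nonempty, ediam (s j i) ^ (n : ℝ) :=
            ENNReal.tsum_le_tsum (hEμ j)
        _ ≤ _ := by rw [ENNReal.tsum_mul_left]; gcongr; exact (hsum j).le
    have htend : Tendsto (fun j : ℕ ↦ Q * (μH[n] U + (j + 1 : ℝ≥0∞)⁻¹)) atTop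
        (𝓝 (Q * (μH[n] U + 0))) := by
      refine ENNReal.Tendsto.const_mul (Tendsto.const_add _ ?_) (Or.inr hQ)
      have := (tendsto_add_atTop_iff_nat 1).2 ENNReal.tendsto_inv_nat_nhds_zero
      simpa using this
    rw [add_zero] at htend
    -- Fatou's lemma.
    calc _ ≤ liminf (fun j ↦ ∫⁻ t, G j t ∂μ) atTop := lintegral_liminf_le hGm
      _ ≤ liminf (fun j : ℕ ↦ Q * (μH[n] U + (j + 1 : ℝ≥0∞)⁻¹)) atTop :=
          liminf_le_liminf (Eventually.of_forall hint)
      _ = _ := htend.liminf_eq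

end Eilenberg

/-! ### Tangencies and the equal-dimensional Sard lemma -/

section Sard

open Metric Set MeasureTheory Filter Asymptotics

variable {V H L : Type*} [NormedAddCommGroup V] [InnerProductSpace ℝ V] [FiniteDimensional ℝ V]
  [NormedAddCommGroup H] [InnerProductSpace ℝ H] [FiniteDimensional ℝ H]
  [NormedAddCommGroup L] [NormedSpace ℝ L]

/-- The images `Φ (t, ·) '' A`, `t ∈ B`, with the difference of the parameters in `W`, are
quantitatively separated. -/
def SeparatedOn (Φ : V × H → H) (B : Set V) (A : Set H) (W : Submodule ℝ V) (C : ℝ) : Prop :=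
  ∀ t ∈ B, ∀ t' ∈ B, ∀ x ∈ A, ∀ x' ∈ A,
    ‖x - x'‖ + ‖t - t'‖ ≤ C * (‖Φ (t, x) - Φ (t', x')‖ + ‖Wᗮ.starProjection (t - t')‖)

variable {Φ : V × H → H} {B : Set V} {A : Set H} {W : Submodule ℝ V} {C : ℝ}

omit [FiniteDimensional ℝ H] in
-- This is the infinitesimal form of separation, obtained along t + σw and a curve in A with
-- velocity τ. As w lies in W, the orthogonal term drops out. It makes the derivative of Φ injective
-- on W × T.
theorem SeparatedOn.norm_add_norm_le (h : SeparatedOn Φ B A W C) (hB : IsOpen B) {t : V}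
    (ht : t ∈ B) {x : H} (hx : x ∈ A) {T : Submodule ℝ H} (hT : HasTangentSpace A x T)
    {Φ' : V × H →L[ℝ] H} (hΦ : HasFDerivAt Φ Φ' (t, x)) {w : V} (hw : w ∈ W) {τ : H}
    (hτ : τ ∈ T) : ‖τ‖ + ‖w‖ ≤ C * ‖Φ' (w, τ)‖ := by
  obtain ⟨c, hc0, hcA, hcd⟩ := hT.exists_curve τ hτ
  have hd₁ : HasDerivAt (fun σ : ℝ ↦ t + σ • w) w 0 := by
    simpa using ((hasDerivAt_id (0 : ℝ)).smul_const w).const_add t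
  have hd₂ : HasDerivAt (fun σ : ℝ ↦ Φ (t + σ • w, c σ)) (Φ' (w, τ)) 0 := by
    have h1 : HasDerivAt (fun σ : ℝ ↦ (t + σ • w, c σ)) (w, τ) 0 := hd₁.prodMk hcd
    exact HasFDerivAt.comp_hasDerivAt (f := fun σ : ℝ ↦ (t + σ • w, c σ)) 0
      (by simpa [hc0] using hΦ) h1
  have l₁ := (hasDerivAt_iff_tendsto_slope_zero.1 hcd).norm
  have l₂ := (hasDerivAt_iff_tendsto_slope_zero.1 hd₂).norm
  refine le_of_tendsto_of_tendsto (l₁.add_const ‖w‖) (l₂.const_mul C) ?_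
  have hB' : ∀ᶠ σ : ℝ in 𝓝 0, t + σ • w ∈ B :=
    hd₁.continuousAt.preimage_mem_nhds (hB.mem_nhds (by simpa using ht))
  filter_upwards [nhdsWithin_le_nhds hB', nhdsWithin_le_nhds hcA, self_mem_nhdsWithin]
    with σ hσB hσA hσ
  have h1 := h _ hσB t ht _ hσA x hx
  have h2 : Wᗮ.starProjection (t + σ • w - t) = 0 :=
    Submodule.starProjection_orthogonal_apply_eq_zero
      (by rw [add_sub_cancel_left]; exact W.smul_mem σ hw)
  rw [h2, norm_zero, add_zero, add_sub_cancel_left, norm_smul] at h1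
  have hσ' : 0 < ‖σ‖ := norm_pos_iff.2 hσ
  simp only [zero_add, zero_smul, add_zero, hc0, norm_smul, norm_inv]
  calc ‖σ‖⁻¹ * ‖c σ - x‖ + ‖w‖ = ‖σ‖⁻¹ * (‖c σ - x‖ + ‖σ‖ * ‖w‖) := by
        field_simp
    _ ≤ ‖σ‖⁻¹ * (C * ‖Φ (t + σ • w, c σ) - Φ (t, x)‖) := by gcongr
    _ = _ := by ring

/-- The parameters `t` for which `Φ (t, ·) '' A` meets the image of `β` depend differentiably on
the component of `t` orthogonal to `W` and on the intersection point. -/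
theorem SeparatedOn.exists_hasFDerivWithinAt (h : SeparatedOn Φ B A W C) {β : L → H}
    {S : Set (L × Wᗮ)} {Gt : L × Wᗮ → V} {Gx : L × Wᗮ → H}
    (hS : ∀ q ∈ S, Gt q ∈ B ∧ Gx q ∈ A ∧ Φ (Gt q, Gx q) = β q.1 ∧
      Wᗮ.starProjection (Gt q) = q.2)
    {q₀ : L × Wᗮ} (hq₀ : q₀ ∈ S) {T : Submodule ℝ H} (hT : HasTangentSpace A (Gx q₀) T)
    {Φ' : V × H →L[ℝ] H} (hΦ : HasFDerivAt Φ Φ' (Gt q₀, Gx q₀)) {β' : L →L[ℝ] H}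
    (hβ : HasFDerivAt β β' q₀.1) (e : (W × T) ≃L[ℝ] H) (he : ∀ w τ, e (w, τ) = Φ' (w, τ)) :
    ∃ G' : L × Wᗮ →L[ℝ] V, HasFDerivWithinAt Gt G' S q₀ ∧
      ∀ b, ∀ τ ∈ T, Φ' (0, τ) = β' b → G' (b, 0) = 0 := by
  -- Linearizing Φ(t, x) = β(b) gives e(δt_W, δx_T) = β' δb - Φ'(δt_⊥, 0) to first order. The
  -- right-hand side is `R`, and `P` extracts δt_W.
  set P : H →L[ℝ] V := W.subtypeL ∘L (ContinuousLinearMap.fst ℝ W T) ∘L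
    (e.symm : H →L[ℝ] W × T) with hP
  set R : L × Wᗮ →L[ℝ] H := β' ∘L ContinuousLinearMap.fst ℝ L Wᗮ -
    Φ' ∘L (ContinuousLinearMap.inl ℝ V H) ∘L Wᗮ.subtypeL ∘L ContinuousLinearMap.snd ℝ L Wᗮ with hR
  refine ⟨Wᗮ.subtypeL ∘L ContinuousLinearMap.snd ℝ L Wᗮ + P ∘L R, ?_, ?_⟩
  · obtain ⟨hB₀, hA₀, hΦ₀, hW₀⟩ := hS q₀ hq₀
    have hβo : HasFDerivWithinAt (fun q : L × Wᗮ ↦ β q.1)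
        (β' ∘L ContinuousLinearMap.fst ℝ L Wᗮ) S q₀ :=
      (hβ.comp q₀ hasFDerivAt_fst).hasFDerivWithinAt
    -- Separation bounds the increments of `Gt` and `Gx` linearly, which also gives continuity at
    -- q₀. No implicit function theorem is needed.
    have hO : (fun q ↦ (Gt q, Gx q) - (Gt q₀, Gx q₀)) =O[𝓝[S] q₀] fun q ↦ q - q₀ := by
      have h1 : (fun q : L × Wᗮ ↦ ‖β q.1 - β q₀.1‖ + ‖q.2 - q₀.2‖) =O[𝓝[S] q₀]
          fun q ↦ q - q₀ :=
        hβo.isBigO_sub.norm_left.add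
          (IsBigO.of_bound 1 (Eventually.of_forall fun q ↦ by
            simpa using norm_snd_le (q - q₀)))
      refine IsBigO.trans (IsBigO.of_bound C ?_) h1
      filter_upwards [self_mem_nhdsWithin] with q hq
      obtain ⟨hqB, hqA, hqΦ, hqW⟩ := hS q hq
      have h2 := h _ hqB _ hB₀ _ hqA _ hA₀
      rw [map_sub, hqΦ, hΦ₀, hqW, hW₀, ← Submodule.coe_sub, ← Submodule.coe_norm] at h2
      rw [Real.norm_of_nonneg (by positivity)]
      refine le_trans ?_ h2
      rw [Prod.mk_sub_mk, Prod.norm_mk]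
      exact max_le (le_add_of_nonneg_left (norm_nonneg _)) (le_add_of_nonneg_right (norm_nonneg _))
    have htend : Tendsto (fun q ↦ (Gt q, Gx q)) (𝓝[S] q₀) (𝓝 (Gt q₀, Gx q₀)) := by
      rw [tendsto_iff_norm_sub_tendsto_zero]
      refine (hO.norm_left.trans_tendsto ?_)
      have : Tendsto (fun q : L × Wᗮ ↦ q - q₀) (𝓝 q₀) (𝓝 (q₀ - q₀)) :=
        (continuous_id.sub continuous_const).tendsto q₀
      rw [sub_self] at this
      exact this.mono_left nhdsWithin_le_nhds
    have htendx : Tendsto Gx (𝓝[S] q₀) (𝓝[A] (Gx q₀)) :=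
      tendsto_nhdsWithin_iff.2 ⟨(continuous_snd.tendsto _).comp htend, by
        filter_upwards [self_mem_nhdsWithin] with q hq using (hS q hq).2.1⟩
    have o₁ := (hΦ.isLittleO.comp_tendsto htend).trans_isBigO hO
    have o₂ := hβo.isLittleO
    have o₃ : (fun q ↦ Tᗮ.starProjection (Gx q - Gx q₀)) =o[𝓝[S] q₀] fun q ↦ q - q₀ :=
      ((hT.isLittleO_starProjection hA₀).comp_tendsto htendx).trans_isBigO
        ((IsBigO.of_bound 1 (Eventually.of_forall fun q ↦ by
          rw [one_mul]; exact norm_snd_le ((Gt q, Gx q) - (Gt q₀, Gx q₀)))).trans hO)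
    have o₄ := (((Φ' ∘L ContinuousLinearMap.inr ℝ V H).isBigO_comp
      (fun q ↦ Tᗮ.starProjection (Gx q - Gx q₀)) (𝓝[S] q₀)).trans_isLittleO o₃)
    have o₅ := (P.isBigO_comp _ (𝓝[S] q₀)).trans_isLittleO ((o₂.sub o₁).sub o₄)
    rw [hasFDerivWithinAt_iff_isLittleO]
    refine o₅.congr' ?_ EventuallyEq.rfl
    filter_upwards [self_mem_nhdsWithin] with q hq
    obtain ⟨hqB, hqA, hqΦ, hqW⟩ := hS q hq
    have k₁ : Gt q - Gt q₀ = W.starProjection (Gt q - Gt q₀) + ((q - q₀).2 : V) := by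
      rw [Prod.snd_sub, Submodule.coe_sub, ← hqW, ← hW₀, ← map_sub,
        W.starProjection_add_starProjection_orthogonal]
    have k₂ : Gx q - Gx q₀ = T.starProjection (Gx q - Gx q₀) + Tᗮ.starProjection (Gx q - Gx q₀) :=
      (T.starProjection_add_starProjection_orthogonal _).symm
    have k₃ : P (Φ' (W.starProjection (Gt q - Gt q₀), T.starProjection (Gx q - Gx q₀)))
        = W.starProjection (Gt q - Gt q₀) := by
      have := he ⟨_, W.starProjection_apply_mem (Gt q - Gt q₀)⟩
        ⟨_, T.starProjection_apply_mem (Gx q - Gx q₀)⟩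
      rw [hP, ← this]
      simp
    have k₄ : Φ' (W.starProjection (Gt q - Gt q₀), T.starProjection (Gx q - Gx q₀))
        = Φ' ((Gt q, Gx q) - (Gt q₀, Gx q₀)) - Φ' ((q - q₀).2, 0)
          - Φ' (0, Tᗮ.starProjection (Gx q - Gx q₀)) := by
      rw [← map_sub, ← map_sub]
      congr 1
      ext1
      · simp only [Prod.mk_sub_mk]; rw [sub_zero]; exact eq_sub_of_add_eq k₁.symm
      · simp only [Prod.mk_sub_mk]; rw [sub_zero]; exact eq_sub_of_add_eq k₂.symm
    simp only [Function.comp_apply, hqΦ, hΦ₀, ContinuousLinearMap.comp_apply,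
      ContinuousLinearMap.coe_fst', ContinuousLinearMap.inr_apply]
    change _ = Gt q - Gt q₀ - (((q - q₀).2 : V) + P (R (q - q₀)))
    have k₅ : Gt q - Gt q₀ - (((q - q₀).2 : V) + P (R (q - q₀))) =
        P (Φ' (W.starProjection (Gt q - Gt q₀), T.starProjection (Gx q - Gx q₀)) -
          R (q - q₀)) := by
      rw [map_sub P, k₃]
      nth_rewrite 1 [k₁]
      abel
    rw [k₅, k₄]
    congr 1
    simp only [hR, sub_apply, ContinuousLinearMap.comp_apply,
      ContinuousLinearMap.coe_fst', ContinuousLinearMap.inl_apply,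
      ContinuousLinearMap.coe_snd', Submodule.subtypeL_apply]
    abel
  · intro b τ hτ hb
    have h1 : R (b, 0) = e (0, ⟨τ, hτ⟩) := by
      rw [he]
      have h0 : Φ' (0, 0) = 0 := map_zero Φ'
      simpa [hR, h0] using hb.symm
    simp [h1, hP]

/-- The parameters `t` for which `Φ (t, ·) '' A` is tangent to the image of `β` form a null
set. -/
theorem SeparatedOn.volume_tangency_eq_zero [MeasurableSpace V] [BorelSpace V]
    [FiniteDimensional ℝ L] (h : SeparatedOn Φ B A W C) (hB : IsOpen B) {d : ℕ}
    (hdim : Module.finrank ℝ H = Module.finrank ℝ W + d)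
    (hL : Module.finrank ℝ L = Module.finrank ℝ W)
    {T : H → Submodule ℝ H} (hT : ∀ x ∈ A, Module.finrank ℝ (T x) = d ∧ HasTangentSpace A x (T x))
    (hΦ : ∀ t ∈ B, ∀ x ∈ A, DifferentiableAt ℝ Φ (t, x)) (β : L → H) :
    volume {t ∈ B | ∃ x ∈ A, ∃ b, ∃ β' : L →L[ℝ] H, HasFDerivAt β β' b ∧ Φ (t, x) = β b ∧
      ∃ v, ∀ τ ∈ T x, ∀ u, fderiv ℝ Φ (t, x) (0, τ) + β' u ≠ v} = 0 := by
  -- Bad parameters are indexed by the coordinate b and the orthogonal component of t, a space of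
  -- the same dimension as V.
  set S : Set (L × Wᗮ) := {q | ∃ t, ∃ x, ∃ β' : L →L[ℝ] H, t ∈ B ∧ x ∈ A ∧
    HasFDerivAt β β' q.1 ∧ Φ (t, x) = β q.1 ∧ Wᗮ.starProjection t = q.2 ∧
    ∃ v, ∀ τ ∈ T x, ∀ u, fderiv ℝ Φ (t, x) (0, τ) + β' u ≠ v} with hS
  have hex : ∀ q ∈ S, ∃ t, ∃ x, ∃ β' : L →L[ℝ] H, t ∈ B ∧ x ∈ A ∧
    HasFDerivAt β β' q.1 ∧ Φ (t, x) = β q.1 ∧ Wᗮ.starProjection t = q.2 ∧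
    ∃ v, ∀ τ ∈ T x, ∀ u, fderiv ℝ Φ (t, x) (0, τ) + β' u ≠ v := fun q hq ↦ hq
  choose! Gt Gx Gβ hGt hGx hGβ hGΦ hGW hGv using hex
  have hder : ∀ q ∈ S, ∃ G' : L × Wᗮ →L[ℝ] V, HasFDerivWithinAt Gt G' S q ∧
      ¬ Function.Injective G' := by
    intro q hq
    have hΦ' := (hΦ _ (hGt q hq) _ (hGx q hq)).hasFDerivAt
    obtain ⟨hTd, hTq⟩ := hT _ (hGx q hq)
    set Φ' := fderiv ℝ Φ (Gt q, Gx q)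
    let J : (W × T (Gx q)) →ₗ[ℝ] H :=
      (Φ' ∘L (W.subtypeL.prodMap (T (Gx q)).subtypeL) : W × T (Gx q) →L[ℝ] H)
    have hJ : ∀ w τ, J (w, τ) = Φ' (w, τ) := fun _ _ ↦ rfl
    have hJinj : Function.Injective J := by
      rw [injective_iff_map_eq_zero]
      rintro ⟨w, τ⟩ h0
      have h1 := h.norm_add_norm_le hB (hGt q hq) (hGx q hq) hTq hΦ' w.2 τ.2
      rw [← hJ, h0, norm_zero, mul_zero] at h1
      have h2 := norm_nonneg (w : V)
      have h3 := norm_nonneg (τ : H)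
      ext1
      · exact Subtype.ext (norm_le_zero_iff.1 (by linarith))
      · exact Subtype.ext (norm_le_zero_iff.1 (by linarith))
    let e : (W × T (Gx q)) ≃L[ℝ] H := (LinearMap.linearEquivOfInjective J hJinj
      (by rw [Module.finrank_prod, hTd, hdim])).toContinuousLinearEquiv
    have he : ∀ w τ, e (w, τ) = Φ' (w, τ) := fun _ _ ↦ rfl
    obtain ⟨G', hG', hG0⟩ := h.exists_hasFDerivWithinAt (Gt := Gt) (Gx := Gx)
      (fun q hq ↦ ⟨hGt q hq, hGx q hq, hGΦ q hq, hGW q hq⟩) hq hTq hΦ' (hGβ q hq) e he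
    refine ⟨G', hG', fun hinj ↦ ?_⟩
    -- If `G'` were injective, so would be `K`; by dimension `K` would then be surjective,
    -- contradicting the missed vector v.
    let K : (T (Gx q) × L) →ₗ[ℝ] H :=
      (J ∘ₗ LinearMap.inr ℝ W (T (Gx q))).coprod (Gβ q : L →ₗ[ℝ] H)
    have hK : ∀ τ u, K (τ, u) = Φ' (0, τ) + Gβ q u := fun _ _ ↦ rfl
    have hKinj : Function.Injective K := by
      rw [injective_iff_map_eq_zero]
      rintro ⟨τ, u⟩ h0
      rw [hK, add_eq_zero_iff_eq_neg, ← map_neg] at h0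
      have h1 := hG0 (-u) τ τ.2 h0
      have h2 : ((-u, 0) : L × Wᗮ) = 0 := hinj (h1.trans (map_zero G').symm)
      have h3 : u = 0 := neg_eq_zero.1 (congrArg Prod.fst h2)
      rw [h3, neg_zero, map_zero] at h0
      have h4 : ((0, τ) : W × T (Gx q)) = 0 := hJinj (h0.trans (map_zero J).symm)
      ext1
      · exact congrArg Prod.snd h4
      · exact h3
    have hKsurj : Function.Surjective K :=
      (LinearMap.injective_iff_surjective_of_finrank_eq_finrank
        (by rw [Module.finrank_prod, hTd, hdim, hL, add_comm])).1 hKinj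
    obtain ⟨v, hv⟩ := hGv q hq
    obtain ⟨⟨τ, u⟩, hτu⟩ := hKsurj v
    exact hv τ τ.2 u hτu
  choose! G' hG' hG'inj using hder
  have hsub : {t ∈ B | ∃ x ∈ A, ∃ b, ∃ β' : L →L[ℝ] H, HasFDerivAt β β' b ∧ Φ (t, x) = β b ∧
      ∃ v, ∀ τ ∈ T x, ∀ u, fderiv ℝ Φ (t, x) (0, τ) + β' u ≠ v} ⊆ Gt '' S := by
    rintro t ⟨ht, x, hx, b, β', hβ', hΦb, hv⟩
    have hq : (b, Wᗮ.orthogonalProjectionOnto t) ∈ S :=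
      ⟨t, x, β', ht, hx, hβ', hΦb, rfl, hv⟩
    refine ⟨_, hq, ?_⟩
    -- The chosen parameter is t itself: both have the same orthogonal component and the same image
    -- point, so the right-hand side of the separation estimate vanishes.
    have h1 := h _ (hGt _ hq) t ht _ (hGx _ hq) x hx
    rw [hGΦ _ hq, map_sub, hGW _ hq, hΦb] at h1
    simp only [sub_self, norm_zero, Submodule.starProjection_apply, add_zero, mul_zero] at h1
    have h2 := norm_nonneg (Gx (b, Wᗮ.orthogonalProjectionOnto t) - x)
    have h3 := norm_nonneg (Gt (b, Wᗮ.orthogonalProjectionOnto t) - t)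
    exact sub_eq_zero.1 (norm_le_zero_iff.1 (by linarith))
  have hrank : Module.finrank ℝ V = Module.finrank ℝ (L × Wᗮ) := by
    rw [Module.finrank_prod, hL, W.finrank_add_finrank_orthogonal]
  let ε : V ≃L[ℝ] L × Wᗮ := ContinuousLinearEquiv.ofFinrankEq hrank
  refine measure_mono_null hsub ?_
  have himg : Gt '' S = (Gt ∘ ε) '' (ε ⁻¹' S) := by
    rw [image_comp, image_preimage_eq _ ε.surjective]
  rw [himg]
  refine addHaar_image_eq_zero_of_det_fderivWithin_eq_zero volume
    (f' := fun t ↦ G' (ε t) ∘L (ε : V →L[ℝ] L × Wᗮ)) (fun t ht ↦ ?_) fun t ht ↦ ?_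
  · exact (hG' _ ht).comp t ε.hasFDerivWithinAt (mapsTo_preimage _ _)
  · by_contra hdet
    refine hG'inj _ ht ?_
    have h1 : Function.Injective (G' (ε t) ∘L (ε : V →L[ℝ] L × Wᗮ)) :=
      (LinearMap.equivOfDetNeZero _ hdet).injective
    intro a b hab
    have h2 : ε.symm a = ε.symm b := h1 (by simpa using hab)
    exact ε.symm.injective h2

end Sard

/-! ### Local transversality for almost every parameter -/

section LocalBounds

open Metric Set MeasureTheory

theorem HasTangentSpace.inter {E : Type*} [NormedAddCommGroup E] [NormedSpace ℝ E] {A : Set E}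
    {x : E} {T : Submodule ℝ E} (h : HasTangentSpace A x T) {O : Set E} (hO : O ∈ 𝓝 x) :
    HasTangentSpace (A ∩ O) x T where
  exists_curve u hu := by
    obtain ⟨c, h0, hc, hd⟩ := h.exists_curve u hu
    refine ⟨c, h0, ?_, hd⟩
    filter_upwards [hc, hd.continuousAt.preimage_mem_nhds (h0 ▸ hO)] with s h1 h2 using ⟨h1, h2⟩
  exists_nhds η hη := by
    obtain ⟨O', hO', h'⟩ := h.exists_nhds η hη
    exact ⟨O', hO', fun y hy y' hy' ↦ h' y ⟨hy.1.1, hy.2⟩ y' ⟨hy'.1.1, hy'.2⟩⟩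

variable {m d n : ℕ} {M : Type*}

section Tangency

variable [TopologicalSpace M] [ChartedSpace (EuclideanSpace ℝ (Fin m)) M]
  [IsManifold (𝓡 m) ∞ M]

theorem IsEmbeddedSubmanifold.exists_hasTangentSpace_inter {S : Set M}
    (hS : IsEmbeddedSubmanifold (m := m) d S) {p : M} {O : Set M} (hO : IsOpen O)
    {y : EuclideanSpace ℝ (Fin m)} (hy : y ∈ chartImage (m := m) p (S ∩ O)) :
    ∃ T : Submodule ℝ (EuclideanSpace ℝ (Fin m)), Module.finrank ℝ T = d ∧
      HasTangentSpace (chartImage (m := m) p (S ∩ O)) y T := by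
  obtain ⟨hyt, hyS, hyO⟩ := hy
  obtain ⟨T, hTd, hT⟩ := hS.exists_hasTangentSpace hyS ((extChartAt (𝓡 m) p).map_target hyt)
  refine ⟨T, hTd, ?_⟩
  rw [(extChartAt (𝓡 m) p).right_inv hyt] at hT
  have : chartImage (m := m) p (S ∩ O) =
      chartImage (m := m) p S ∩ (extChartAt (𝓡 m) p).symm ⁻¹' O := by
    simp only [chartImage, preimage_inter, inter_assoc]
  rw [this]
  exact hT.inter ((continuousAt_extChartAt_symm'' hyt).preimage_mem_nhds (hO.mem_nhds hyO))

variable {V : Type*} [NormedAddCommGroup V] [InnerProductSpace ℝ V]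
  [FiniteDimensional ℝ V] [MeasurableSpace V] [BorelSpace V]
  {X : V →ₗ[ℝ] Cₛ^∞⟮𝓡 m; EuclideanSpace ℝ (Fin m), (TangentSpace (𝓡 m) : M → Type _)⟯}

/-- The perturbations of `N` are transverse to `N'` near `p`, for almost every parameter. -/
theorem SeparatedOn.volume_not_transverse_eq_zero (hdn : d + n = m) {p : M} {N O : Set M}
    (hN : IsEmbeddedSubmanifold (m := m) d N) (hO : IsOpen O)
    (hOs : O ⊆ (extChartAt (𝓡 m) p).source) {B : Set V} (hB : IsOpen B)
    {Φ : V × EuclideanSpace ℝ (Fin m) → EuclideanSpace ℝ (Fin m)}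
    (hΦ : ∀ t ∈ B, ∀ x ∈ O, timeOneMap (X t) x ∈ (extChartAt (𝓡 m) p).source ∧
      extChartAt (𝓡 m) p (timeOneMap (X t) x) = Φ (t, extChartAt (𝓡 m) p x) ∧
      DifferentiableAt ℝ Φ (t, extChartAt (𝓡 m) p x))
    {W : Submodule ℝ V} (hW : Module.finrank ℝ W = n) {C : ℝ}
    (hsep : SeparatedOn Φ B (chartImage (m := m) p (N ∩ O)) W C)
    {N' : Set M} (hN'c : IsCompact N') (hN' : IsEmbeddedSubmanifold (m := m) n N') :
    volume {t ∈ B | ∃ x ∈ N ∩ O, timeOneMap (X t) x ∈ N' ∧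
      tangentSpaceOfSet (m := m) (timeOneMap (X t) '' N) (timeOneMap (X t) x) ⊔
        tangentSpaceOfSet (m := m) N' (timeOneMap (X t) x) ≠ ⊤} = 0 := by
  have hTex : ∀ y ∈ chartImage (m := m) p (N ∩ O),
      ∃ T : Submodule ℝ (EuclideanSpace ℝ (Fin m)), Module.finrank ℝ T = d ∧
      HasTangentSpace (chartImage (m := m) p (N ∩ O)) y T :=
    fun y hy ↦ hN.exists_hasTangentSpace_inter hO hy
  choose! T hT using hTex
  have hsymm : ∀ t ∈ B, ∀ y ∈ chartImage (m := m) p (N ∩ O),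
      (extChartAt (𝓡 m) p).symm (Φ (t, y)) ∈ timeOneMap (X t) '' N := by
    rintro t ht y ⟨hyt, hyN, hyO⟩
    refine ⟨_, hyN, ?_⟩
    obtain ⟨h1, h2, -⟩ := hΦ t ht _ hyO
    rw [(extChartAt (𝓡 m) p).right_inv hyt] at h2
    rw [← h2, (extChartAt (𝓡 m) p).left_inv h1]
  -- Doubling N' lets compact induction shrink the second copy, while the tangent spaces still refer
  -- to all of N'.
  suffices H : volume {t ∈ B | ∃ x ∈ N ∩ O, timeOneMap (X t) x ∈ N' ∩ N' ∧
      tangentSpaceOfSet (m := m) (timeOneMap (X t) '' N) (timeOneMap (X t) x) ⊔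
        tangentSpaceOfSet (m := m) N' (timeOneMap (X t) x) ≠ ⊤} = 0 by
    rwa [inter_self] at H
  refine hN'c.induction_on (p := fun s ↦ volume {t ∈ B | ∃ x ∈ N ∩ O, timeOneMap (X t) x ∈ N' ∩ s ∧
      tangentSpaceOfSet (m := m) (timeOneMap (X t) '' N) (timeOneMap (X t) x) ⊔
        tangentSpaceOfSet (m := m) N' (timeOneMap (X t) x) ≠ ⊤} = 0) (by simp) ?_ ?_ ?_
  · intro s s' hss' h0
    refine measure_mono_null ?_ h0
    rintro t ⟨ht, x, hx, hy, hne⟩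
    exact ⟨ht, x, hx, ⟨hy.1, hss' hy.2⟩, hne⟩
  · intro s s' h0 h0'
    refine measure_mono_null ?_ (measure_union_null h0 h0')
    rintro t ⟨ht, x, hx, ⟨hy, hy' | hy'⟩, hne⟩
    · exact Or.inl ⟨ht, x, hx, ⟨hy, hy'⟩, hne⟩
    · exact Or.inr ⟨ht, x, hx, ⟨hy, hy'⟩, hne⟩
  intro z hz
  obtain ⟨κ, hκ, hzκ, L, hLn, hL⟩ := hN' z hz
  refine ⟨κ.source, mem_nhdsWithin_of_mem_nhds (κ.open_source.mem_nhds hzκ), ?_⟩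
  -- Near z, N' is parametrized by L through the inverse of the adapted chart; this is the map β of
  -- the tangency lemma.
  refine measure_mono_null ?_ (hsep.volume_tangency_eq_zero (L := L) hB (d := d)
    (by rw [finrank_euclideanSpace_fin, hW]; omega) (by rw [hLn, hW]) hT ?_
    fun b ↦ extChartAt (𝓡 m) p (κ.symm b))
  · rintro t ⟨ht, x, hx, ⟨hyN', hyκ⟩, hne⟩
    obtain ⟨hys, hyΦ, hyd⟩ := hΦ t ht x hx.2
    set y := timeOneMap (X t) x with hy
    obtain ⟨ψ, hψ, -⟩ := exists_hasStrictFDerivAt_transition hκ hys hyκ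
    have hxA := extChartAt_mem_chartImage (hOs hx.2) hx
    set b : L := ⟨κ y, (hL y hyκ).1 hyN'⟩ with hb
    have hβ : HasFDerivAt (fun b : L ↦ extChartAt (𝓡 m) p (κ.symm b))
        ((ψ : EuclideanSpace ℝ (Fin m) →L[ℝ] EuclideanSpace ℝ (Fin m)) ∘L L.subtypeL) b :=
      HasFDerivAt.comp (g := extChartAt (𝓡 m) p ∘ κ.symm) b hψ.hasFDerivAt
        L.subtypeL.hasFDerivAt
    refine ⟨ht, _, hxA, b, _, hβ, ?_, ?_⟩
    · rw [← hyΦ, hb, κ.left_inv hyκ]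
    by_contra! hsurj
    refine hne (eq_top_iff.2 fun w _ ↦ ?_)
    obtain ⟨τ, hτ, u, hτu⟩ := hsurj (tangentCoordChange (𝓡 m) y p y w)
    have hw : (w : EuclideanSpace ℝ (Fin m)) =
        tangentCoordChange (𝓡 m) p y y (fderiv ℝ Φ (t, extChartAt (𝓡 m) p x) (0, τ)) +
        tangentCoordChange (𝓡 m) p y y (ψ u) := by
      rw [← map_add, ← tangentCoordChange_tangentCoordChange hys w, ← hτu]
      rfl
    rw [show w = _ from hw]
    refine Submodule.add_mem_sup ?_ ?_
    · obtain ⟨c, hc0, hcA, hcd⟩ := (hT _ hxA).2.exists_curve τ hτ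
      refine mem_tangentSpaceOfSet_of_hasDerivAt hys (c := fun σ ↦ Φ (t, c σ))
        (by simp only [hc0, hyΦ]) (hcA.mono fun s hs ↦ hsymm t ht _ hs) ?_
      rw [tangentCoordChange_tangentCoordChange' hys]
      exact HasFDerivAt.comp_hasDerivAt (f := fun σ : ℝ ↦ (t, c σ)) 0
        (by simpa [hc0] using hyd.hasFDerivAt) ((hasDerivAt_const _ t).prodMk hcd)
    · have hcu : HasDerivAt (fun σ : ℝ ↦ b + σ • u) u 0 := by
        simpa using ((hasDerivAt_id (0 : ℝ)).smul_const u).const_add b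
      have hcy : κ.symm (b : EuclideanSpace ℝ (Fin m)) = y := κ.left_inv hyκ
      have hct : ContinuousAt (fun σ : ℝ ↦ κ.symm ((b + σ • u : L) : EuclideanSpace ℝ (Fin m))) 0 :=
        ContinuousAt.comp (g := κ.symm) (by
          simpa using κ.symm.continuousAt (κ.map_source hyκ))
          (continuous_subtype_val.continuousAt.comp hcu.continuousAt)
      have hct0 : κ.symm ((b + (0 : ℝ) • u : L) : EuclideanSpace ℝ (Fin m)) = y := by
        rw [zero_smul, add_zero, hcy]
      refine mem_tangentSpaceOfSet_of_hasDerivAt hys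
        (c := fun σ : ℝ ↦ extChartAt (𝓡 m) p (κ.symm ((b + σ • u : L) : EuclideanSpace ℝ (Fin m))))
        (by simp only [hct0]) ?_ ?_
      · have e1 := hct.preimage_mem_nhds (by
          rw [hct0]; exact (isOpen_extChartAt_source (I := 𝓡 m) p).mem_nhds hys)
        have e2 : ∀ᶠ σ : ℝ in 𝓝 0, ((b + σ • u : L) : EuclideanSpace ℝ (Fin m)) ∈ κ.target :=
          (continuous_subtype_val.continuousAt.comp hcu.continuousAt).preimage_mem_nhds
            (κ.open_target.mem_nhds (by simpa using κ.map_source hyκ))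
        filter_upwards [e1, e2] with σ h1 h2
        rw [(extChartAt (𝓡 m) p).left_inv h1, hL _ (κ.map_target h2), κ.right_inv h2]
        exact Subtype.mem _
      · rw [tangentCoordChange_tangentCoordChange' hys]
        exact HasFDerivAt.comp_hasDerivAt (f := fun σ : ℝ ↦ b + σ • u) 0
          (by simpa using hβ) hcu
  · rintro t ht y ⟨hyt, -, hyO⟩
    have := (hΦ t ht _ hyO).2.2
    rwa [(extChartAt (𝓡 m) p).right_inv hyt] at this

end Tangency

end LocalBounds

/-! ### From local to global bounds -/

section UniformBounds

open Metric Set MeasureTheory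

variable {m d n : ℕ} {M : Type*} [EMetricSpace M] [ChartedSpace (EuclideanSpace ℝ (Fin m)) M]
  [IsManifold (𝓡 m) ∞ M] {V : Type*} [NormedAddCommGroup V] [InnerProductSpace ℝ V]
  [FiniteDimensional ℝ V] [MeasurableSpace V] [BorelSpace V]
  {X : V →ₗ[ℝ] Cₛ^∞⟮𝓡 m; EuclideanSpace ℝ (Fin m), (TangentSpace (𝓡 m) : M → Type _)⟯}

omit [IsManifold (𝓡 m) ∞ M] in
-- The chart is C'-Lipschitz on O', so points of A in O' are at chart distance at most ρ = C' diam
-- A. Separation then gives the slice bound with this ρ.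
theorem SeparatedOn.volume_closure_le {p : M} {N O O' : Set M}
    (hOs : O ⊆ (extChartAt (𝓡 m) p).source) {C' : NNReal}
    (hO' : ∀ x ∈ O', ∀ y ∈ O', edist (extChartAt (𝓡 m) p x) (extChartAt (𝓡 m) p y) ≤
      C' * edist x y) {ε : ℝ} (hε : 0 ≤ ε) {f : V → M → M}
    {Φ : V × EuclideanSpace ℝ (Fin m) → EuclideanSpace ℝ (Fin m)}
    (hΦ : ∀ t ∈ ball (0 : V) ε, ∀ x ∈ O, f t x ∈ O' ∧
      extChartAt (𝓡 m) p (f t x) = Φ (t, extChartAt (𝓡 m) p x))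
    {W : Submodule ℝ V} (hW : Module.finrank ℝ W = n) {C : ℝ} (hC : 0 ≤ C)
    (hsep : SeparatedOn Φ (ball 0 ε) (chartImage (m := m) p (N ∩ O)) W C)
    {A : Set M} (hA : ediam A ≠ ⊤) :
    volume (closure {t ∈ ball (0 : V) ε | (f t '' (N ∩ O) ∩ A).Nonempty}) ≤
      ENNReal.ofReal (2 ^ (Module.finrank ℝ V - n) * (2 * (C * C')) ^ n *
        ε ^ (Module.finrank ℝ V - n)) * ediam A ^ n := by
  refine (volume_closure_le_of_slices W hW (ρ := C' * (ediam A).toReal) hε hC (by positivity)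
    (fun t ht ↦ ht.1) ?_).trans_eq ?_
  · rintro t ⟨ht, _, ⟨x, hx, rfl⟩, hxA⟩ t' ⟨ht', _, ⟨x', hx', rfl⟩, hxA'⟩
    obtain ⟨h1, h2⟩ := hΦ t ht x hx.2
    obtain ⟨h1', h2'⟩ := hΦ t' ht' x' hx'.2
    have h3 := hsep t ht t' ht' _ (extChartAt_mem_chartImage (hOs hx.2) hx) _
      (extChartAt_mem_chartImage (hOs hx'.2) hx')
    rw [← h2, ← h2', ← dist_eq_norm (extChartAt (𝓡 m) p (f t x))] at h3
    have h4 : dist (extChartAt (𝓡 m) p (f t x)) (extChartAt (𝓡 m) p (f t' x')) ≤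
        C' * (ediam A).toReal := by
      rw [dist_edist, ← ENNReal.coe_toReal C', ← ENNReal.toReal_mul]
      refine ENNReal.toReal_mono (ENNReal.mul_ne_top ENNReal.coe_ne_top hA)
        ((hO' _ h1 _ h1').trans ?_)
      gcongr
      exact edist_le_ediam_of_mem hxA hxA'
    calc ‖t - t'‖ ≤ _ := le_add_of_nonneg_left (norm_nonneg _)
      _ ≤ _ := h3
      _ ≤ _ := by gcongr
  · have : (2 * ε) ^ (Module.finrank ℝ V - n) * (2 * (C * (C' * (ediam A).toReal))) ^ n =
        2 ^ (Module.finrank ℝ V - n) * (2 * (C * C')) ^ n * ε ^ (Module.finrank ℝ V - n) *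
          (ediam A).toReal ^ n := by ring
    rw [this, ENNReal.ofReal_mul (by positivity), ENNReal.ofReal_pow ENNReal.toReal_nonneg,
      ENNReal.ofReal_toReal hA]

variable [RiemannianBundle (fun x : M ↦ TangentSpace (𝓡 m) x)]
  [IsContinuousRiemannianBundle (EuclideanSpace ℝ (Fin m)) (fun x : M ↦ TangentSpace (𝓡 m) x)]
  [IsRiemannianManifold (𝓡 m) M] [CompactSpace M]

/-- O, ε₀ and C are fixed before N, which gives uniformity over F; only W varies with N. The
inequality n ≤ dim V gives the truncated exponent dim V - n its true value. -/
theorem ControlledAt.exists_local_bounds (hdn : d + n = m) {F : Set (Set M)} {p : M}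
    (h : ControlledAt X n F p) (hF : ∀ N ∈ F, IsEmbeddedSubmanifold (m := m) d N) :
    ∃ O ∈ 𝓝 p, ∃ ε₀ > 0, ∃ C > 0, ∀ N ∈ F, (N ∩ O).Nonempty → n ≤ Module.finrank ℝ V ∧
      (∀ ε, 0 < ε → ε ≤ ε₀ → ∀ A : Set M, ediam A ≠ ⊤ →
        volume (closure {t ∈ ball (0 : V) ε | (timeOneMap (X t) '' (N ∩ O) ∩ A).Nonempty}) ≤
          ENNReal.ofReal (C * ε ^ (Module.finrank ℝ V - n)) * ediam A ^ n) ∧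
      ∀ N' : Set M, IsCompact N' → IsEmbeddedSubmanifold (m := m) n N' →
        volume {t ∈ ball (0 : V) ε₀ | ∃ x ∈ N ∩ O, timeOneMap (X t) x ∈ N' ∧
          tangentSpaceOfSet (m := m) (timeOneMap (X t) '' N) (timeOneMap (X t) x) ⊔
            tangentSpaceOfSet (m := m) N' (timeOneMap (X t) x) ≠ ⊤} = 0 := by
  obtain ⟨C', hC', O', hO', hedist⟩ := exists_nhds_edist_extChartAt_le (m := m) p
  obtain ⟨O, hO, hOs, ε₀, hε₀, C, hC, Φ, hΦ, hsep⟩ := h.exists_separation hO'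
  refine ⟨interior O, interior_mem_nhds.2 hO, ε₀, hε₀,
    2 ^ (Module.finrank ℝ V - n) * (2 * (C * C')) ^ n, by positivity, fun N hN hne ↦ ?_⟩
  obtain ⟨W, hW, hWsep⟩ := hsep N hN (hne.mono (inter_subset_inter_right _ interior_subset))
  have hs : SeparatedOn Φ (ball 0 ε₀) (chartImage (m := m) p (N ∩ interior O)) W C := by
    rintro t ht t' ht' y ⟨hyt, hyN, hyO⟩ y' ⟨hyt', hyN', hyO'⟩
    have := hWsep t ht t' ht' _ ⟨hyN, interior_subset hyO⟩ _ ⟨hyN', interior_subset hyO'⟩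
    rwa [(extChartAt (𝓡 m) p).right_inv hyt, (extChartAt (𝓡 m) p).right_inv hyt'] at this
  refine ⟨hW ▸ W.finrank_le, fun ε hε hε₀ A hA ↦ ?_, fun N' hN'c hN' ↦ ?_⟩
  · have hb := ball_subset_ball (x := (0 : V)) hε₀
    exact SeparatedOn.volume_closure_le (interior_subset.trans hOs) hedist hε.le
      (fun t ht x hx ↦ ⟨(hΦ t (hb ht) x (interior_subset hx)).2.1,
        (hΦ t (hb ht) x (interior_subset hx)).2.2.1⟩) hW hC.le
      (fun t ht t' ht' ↦ hs t (hb ht) t' (hb ht')) hA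
  · exact hs.volume_not_transverse_eq_zero hdn (hF N hN) isOpen_interior
      (interior_subset.trans hOs) isOpen_ball
      (fun t ht x hx ↦ ⟨(hΦ t ht x (interior_subset hx)).1,
        (hΦ t ht x (interior_subset hx)).2.2⟩) hW hN'c hN'

theorem exists_uniform_bounds (hdn : d + n = m) {F : Set (Set M)}
    (h : ∀ p, ControlledAt X n F p) (hF : ∀ N ∈ F, IsEmbeddedSubmanifold (m := m) d N) :
    ∃ ε₀ > 0, ∃ C > 0, ∀ N ∈ F, N.Nonempty → n ≤ Module.finrank ℝ V ∧
      (∀ ε, 0 < ε → ε ≤ ε₀ → ∀ A : Set M, ediam A ≠ ⊤ → ∃ E, MeasurableSet E ∧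
        (∀ t ∈ ball (0 : V) ε, (timeOneMap (X t) '' N ∩ A).Nonempty → t ∈ E) ∧
        volume E ≤ ENNReal.ofReal (C * ε ^ (Module.finrank ℝ V - n)) * ediam A ^ n) ∧
      ∀ N' : Set M, IsCompact N' → IsEmbeddedSubmanifold (m := m) n N' →
        volume {t ∈ ball (0 : V) ε₀ |
          ¬ IntersectTransversely (m := m) (timeOneMap (X t) '' N) N'} = 0 := by
  choose O hO ε₀ hε₀ C hC hloc using fun p ↦ (h p).exists_local_bounds hdn hF
  obtain ⟨s, -, hs⟩ := isCompact_univ.elim_nhds_subcover O fun p _ ↦ hO p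
  have hcov : ∀ x, ∃ p ∈ s, x ∈ O p := fun x ↦ by simpa using hs (mem_univ x)
  obtain ⟨ε₁, hε₁, hε₁le⟩ := Finset.exists_pos_forall_le s hε₀
  -- The summand 1 keeps the constant positive when the finite cover is empty.
  refine ⟨ε₁, hε₁, ∑ p ∈ s, C p + 1, by
    have := Finset.sum_nonneg fun p (_ : p ∈ s) ↦ (hC p).le
    positivity, fun N hN hne ↦ ⟨?_, fun ε hε hεε A hA ↦ ?_, fun N' hN'c hN' ↦ ?_⟩⟩
  · obtain ⟨x, hx⟩ := hne
    obtain ⟨p, -, hxp⟩ := hcov x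
    exact (hloc p N hN ⟨x, hx, hxp⟩).1
  · refine ⟨⋃ p ∈ s, closure {t ∈ ball (0 : V) ε |
      (timeOneMap (X t) '' (N ∩ O p) ∩ A).Nonempty},
      s.measurableSet_biUnion fun p _ ↦ isClosed_closure.measurableSet, ?_, ?_⟩
    · rintro t ht ⟨_, ⟨x, hx, rfl⟩, hxA⟩
      obtain ⟨p, hp, hxp⟩ := hcov x
      exact mem_biUnion hp (subset_closure ⟨ht, _, ⟨x, ⟨hx, hxp⟩, rfl⟩, hxA⟩)
    · calc _ ≤ ∑ p ∈ s, volume (closure {t ∈ ball (0 : V) ε |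
            (timeOneMap (X t) '' (N ∩ O p) ∩ A).Nonempty}) := measure_biUnion_finset_le _ _
        _ ≤ ∑ p ∈ s, ENNReal.ofReal (C p * ε ^ (Module.finrank ℝ V - n)) * ediam A ^ n := by
            refine Finset.sum_le_sum fun p hp ↦ ?_
            rcases (N ∩ O p).eq_empty_or_nonempty with h0 | h0
            · simp [h0]
            · exact (hloc p N hN h0).2.1 ε hε (hεε.trans (hε₁le p hp)) A hA
        _ = ENNReal.ofReal ((∑ p ∈ s, C p) * ε ^ (Module.finrank ℝ V - n)) * ediam A ^ n := by
            rw [← Finset.sum_mul, ← ENNReal.ofReal_sum_of_nonneg, Finset.sum_mul]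
            exact fun p _ ↦ mul_nonneg (hC p).le (by positivity)
        _ ≤ _ := by
            gcongr
            linarith
  · refine measure_mono_null (t := ⋃ p ∈ s, {t ∈ ball (0 : V) (ε₀ p) | ∃ x ∈ N ∩ O p,
      timeOneMap (X t) x ∈ N' ∧
          tangentSpaceOfSet (m := m) (timeOneMap (X t) '' N) (timeOneMap (X t) x) ⊔
            tangentSpaceOfSet (m := m) N' (timeOneMap (X t) x) ≠ ⊤}) ?_ ?_
    · rintro t ⟨ht, hnt⟩
      simp only [IntersectTransversely, not_forall] at hnt
      obtain ⟨_, ⟨⟨x, hx, rfl⟩, hxN'⟩, hne⟩ := hnt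
      obtain ⟨p, hp, hxp⟩ := hcov x
      exact mem_biUnion hp ⟨ball_subset_ball (hε₁le p hp) ht, x, ⟨hx, hxp⟩, hxN', hne⟩
    · refine (measure_biUnion_null_iff s.countable_toSet).2 fun p _ ↦ ?_
      rcases (N ∩ O p).eq_empty_or_nonempty with h0 | h0
      · simp [h0]
      · exact (hloc p N hN h0).2.2 N' hN'c hN'

end UniformBounds

/-! ### Averaging over the parameter -/

section Selection

open Metric Set MeasureTheory

variable {m d n : ℕ} {M : Type*} [EMetricSpace M] [MeasurableSpace M] [BorelSpace M]
  [CompactSpace M] [ChartedSpace (EuclideanSpace ℝ (Fin m)) M] [IsManifold (𝓡 m) ∞ M]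
  [RiemannianBundle (fun x : M ↦ TangentSpace (𝓡 m) x)]
  [IsContinuousRiemannianBundle (EuclideanSpace ℝ (Fin m)) (fun x : M ↦ TangentSpace (𝓡 m) x)]
  [IsRiemannianManifold (𝓡 m) M]
  {V : Type*} [NormedAddCommGroup V] [InnerProductSpace ℝ V] [FiniteDimensional ℝ V]
  {X : V →ₗ[ℝ] Cₛ^∞⟮𝓡 m; EuclideanSpace ℝ (Fin m), (TangentSpace (𝓡 m) : M → Type _)⟯}

theorem exists_perturbedIntersectionBound (hdn : d + n = m) {F : Set (Set M)}
    (h : ∀ p, ControlledAt X n F p) (hF : ∀ N ∈ F, IsEmbeddedSubmanifold (m := m) d N) :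
    ∃ C > 0, ∃ ε₀ > 0, ∀ N ∈ F, PerturbedIntersectionBound X n N C ε₀ := by
  let _ : MeasurableSpace V := borel V
  have _ : BorelSpace V := ⟨rfl⟩
  obtain ⟨ε₀, hε₀, C, hC, hbd⟩ := exists_uniform_bounds hdn h hF
  obtain ⟨c, hc, hcH⟩ : ∃ c : NNReal, c ≠ 0 ∧ ∀ U : Set M,
      Measure.euclideanHausdorffMeasure n U = c * μH[n] U :=
    ⟨_, Measure.addHaarScalarFactor_volume_hausdorffMeasure_ne_zero n, fun U ↦ by
      rw [Measure.euclideanHausdorffMeasure_def]; rfl⟩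
  set b : ℝ := (volume (ball (0 : V) 1)).toReal with hb
  have hb0 : 0 < b := ENNReal.toReal_pos (measure_ball_pos _ _ one_pos).ne' measure_ball_lt_top.ne
  have hc0 : (0 : ℝ) < c := by positivity
  -- The integral bound C ε^(k-n) is divided by the ball volume b ε^k, and c converts the Hausdorff
  -- measure to its Euclidean normalization.
  refine ⟨C / (b * c), by positivity, ε₀, hε₀, fun N hN ε hε hεε₀ N' hN'c hN' U hU ↦ ?_⟩
  -- Empty N is separated because the bounds, including n ≤ k, are available only for nonempty N.
  rcases N.eq_empty_or_nonempty with rfl | hne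
  · exact ⟨0, mem_ball_self hε, by simp [IntersectTransversely], by simp⟩
  obtain ⟨hnk, hbound, htrans⟩ := hbd N hN hne
  set k := Module.finrank ℝ V
  have hvol : volume (ball (0 : V) ε) = ENNReal.ofReal (ε ^ k * b) := by
    rw [Measure.addHaar_ball_of_pos _ _ hε, ENNReal.ofReal_mul (by positivity), hb,
      ENNReal.ofReal_toReal measure_ball_lt_top.ne]
  have hvol0 : volume.restrict (ball (0 : V) ε) ≠ 0 := by
    rw [Ne, Measure.restrict_eq_zero]
    exact (measure_ball_pos _ _ hε).ne'
  have : IsFiniteMeasure (volume.restrict (ball (0 : V) ε)) :=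
    isFiniteMeasure_restrict.2 measure_ball_lt_top.ne
  have hsel : ∀ G : V → ℝ≥0∞, Measurable G → ∃ t ∈ ball (0 : V) ε,
      IntersectTransversely (m := m) (timeOneMap (X t) '' N) N' ∧
      G t ≤ ⨍⁻ a, G a ∂volume.restrict (ball (0 : V) ε) := by
    intro G hG
    -- The complement of the ball is null for the restricted measure; adding it to the bad set
    -- forces the selected t into the ball.
    have hnull : volume.restrict (ball (0 : V) ε) ({t ∈ ball (0 : V) ε₀ |
        ¬ IntersectTransversely (m := m) (timeOneMap (X t) '' N) N'} ∪ (ball (0 : V) ε)ᶜ) = 0 := by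
      refine measure_union_null ?_ ?_
      · exact le_antisymm ((Measure.restrict_apply_le _ _).trans (htrans N' hN'c hN').le) zero_le
      · rw [Measure.restrict_apply measurableSet_ball.compl, compl_inter_self, measure_empty]
    obtain ⟨t, ht, hle⟩ := exists_notMem_null_le_laverage hvol0 hG.aemeasurable hnull
    rw [mem_union, not_or, notMem_compl_iff] at ht
    refine ⟨t, ht.2, ?_, hle⟩
    by_contra hnt
    exact ht.1 ⟨ball_subset_ball hεε₀.le ht.2, hnt⟩
  have hCε : 0 < C / (b * c) / ε ^ n := by positivity
  -- If the measure of U is infinite the bound is trivial, and only transversality has to be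
  -- arranged.
  by_cases hUtop : μH[n] U = ⊤
  · obtain ⟨t, ht, htr, -⟩ := hsel 0 measurable_zero
    refine ⟨t, ht, htr, ?_⟩
    rw [hcH, hUtop, ENNReal.mul_top (by exact_mod_cast hc), ENNReal.mul_top (by simpa using hCε)]
    exact le_top
  · obtain ⟨G, hG, hGle, hGint⟩ := exists_lintegral_le_hausdorffMeasure (μ := volume)
      (fun t ↦ timeOneMap (X t) '' N) (Q := ENNReal.ofReal (C * ε ^ (k - n)))
      ENNReal.ofReal_ne_top (B := ball (0 : V) ε)
      (fun A _ hA ↦ hbound ε hε hεε₀.le A hA) hUtop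
    obtain ⟨t, ht, htr, hGt⟩ := hsel G hG
    refine ⟨t, ht, htr, (hGle t ht).trans (hGt.trans ?_)⟩
    have hconst : ENNReal.ofReal (C * ε ^ (k - n)) / ENNReal.ofReal (ε ^ k * b) =
        ENNReal.ofReal (C / (b * c) / ε ^ n) * c := by
      rw [← ENNReal.ofReal_div_of_pos (by positivity), ← ENNReal.ofReal_coe_nnreal,
        ← ENNReal.ofReal_mul hCε.le, ← Nat.sub_add_cancel hnk, pow_add, Nat.add_sub_cancel]
      congr 1
      field_simp
    calc ⨍⁻ a, G a ∂volume.restrict (ball (0 : V) ε)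
        = (∫⁻ a in ball (0 : V) ε, G a) / volume (ball (0 : V) ε) := setLAverage_eq _ _ _
      _ ≤ ENNReal.ofReal (C * ε ^ (k - n)) * μH[n] U / ENNReal.ofReal (ε ^ k * b) := by
          rw [hvol]
          gcongr
          exact (setLIntegral_le_lintegral _ _).trans hGint
      _ = _ := by rw [hcH, ENNReal.mul_div_right_comm, hconst, mul_assoc]

end Selection

theorem proposition2p4 {m d n : ℕ} (hdn : d + n = m)
    {M : Type*} [EMetricSpace M] [MeasurableSpace M] [BorelSpace M] [CompactSpace M]
    [ChartedSpace (EuclideanSpace ℝ (Fin m)) M] [IsManifold (𝓡 m) ∞ M]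
    [RiemannianBundle (fun x : M => TangentSpace (𝓡 m) x)]
    [IsContMDiffRiemannianBundle (𝓡 m) ∞ (EuclideanSpace ℝ (Fin m))
      (fun x : M => TangentSpace (𝓡 m) x)]
    [IsRiemannianManifold (𝓡 m) M]
    {V : Type*} [NormedAddCommGroup V] [InnerProductSpace ℝ V] [FiniteDimensional ℝ V]
    (X : V →ₗ[ℝ] Cₛ^∞⟮𝓡 m; EuclideanSpace ℝ (Fin m), (TangentSpace (𝓡 m) : M → Type _)⟯) :
    (∀ N : Set M, IsCompact N → IsEmbeddedSubmanifold (m := m) d N → SurjectsOntoNormal X N →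
      ∃ C > 0, ∃ ε₀ > 0, PerturbedIntersectionBound X n N C ε₀) ∧
    (∀ F : Set (Set M), (∀ N ∈ F, IsCompact N ∧ IsEmbeddedSubmanifold (m := m) d N) →
      UniformlyC1 (m := m) d F → UniformlySurjectsOntoNormal X F →
      ∃ C > 0, ∃ ε₀ > 0, ∀ N ∈ F, PerturbedIntersectionBound X n N C ε₀) := by
  have : IsContinuousRiemannianBundle (EuclideanSpace ℝ (Fin m))
      (fun x : M => TangentSpace (𝓡 m) x) := isContinuousRiemannianBundle_tangentSpace
  refine ⟨fun N hNc hN hX ↦ ?_, fun F hF hC1 hX ↦ ?_⟩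
  · obtain ⟨C, hC, ε₀, hε₀, h⟩ := exists_perturbedIntersectionBound hdn (F := {N})
      (controlledAt_singleton X hdn hNc hN hX) (by rintro _ rfl; exact hN)
    exact ⟨C, hC, ε₀, hε₀, h N rfl⟩
  · exact exists_perturbedIntersectionBound hdn
      (controlledAt_of_uniform X hdn (fun N hN ↦ (hF N hN).2) hC1 hX) fun N hN ↦ (hF N hN).2
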